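/- Let $F$ be a field. An \emph{alternative quadrialgebra} over $F$ is an $F$-vector space $A$ with four bilinear products $\nearrow,\searrow,\swarrow,\nwarrow$ such that, for all $x,y,z\in A$, \begin{align*} &(x,y,z)_r+(y,x,z)_m=0, && (x,y,z)_r+(x,z,y)_r=0, && (x,y,z)_n+(y,x,z)_w=0,\\ &(x,y,z)_n+(x,z,y)_{ne}=0, && (x,y,z)_{ne}+(y,x,z)_e=0, && (x,y,z)_w+(x,z,y)_{sw}=0,\\ &(x,y,z)_{sw}+(y,x,z)_s=0, && (x,y,z)_m+(x,z,y)_\ell=0, && (x,y,z)_\ell+(y,x,z)_\ell=0, \end{align*} where $x\succ y=x\nearrow y+x\searrow y$, $x\prec y=x\nwarrow y+x\swarrow y$, $x\vee y=x\searrow y+x\swarrow y$, $x\wedge y=x\nearrow y+x\nwarrow y$, $x*y=x\succ y+x\prec y$ and \begin{align*} (x,y,z)_r&=(x\nwarrow y)\nwarrow z-x\nwarrow(y*z), & (x,y,z)_\ell&=(x*y)\searrow z-x\searrow(y\searrow z),\\ (x,y,z)_{ne}&=(x\wedge y)\nearrow z-x\nearrow(y\succ z), & (x,y,z)_{sw}&=(x\prec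 y)\swarrow z-x\swarrow(y\vee z),\\ (x,y,z)_n&=(x\nearrow y)\nwarrow z-x\nearrow(y\prec z), & (x,y,z)_w&=(x\swarrow y)\nwarrow z-x\swarrow(y\wedge z),\\ (x,y,z)_s&=(x\succ y)\swarrow z-x\searrow(y\swarrow z), & (x,y,z)_e&=(x\vee y)\nearrow z-x\searrow(y\nearrow z),\\ (x,y,z)_m&=(x\searrow y)\nwarrow z-x\searrow(y\nwarrow z). \end{align*} A \emph{J-dendriform algebra} is an $F$-vector space with two bilinear products $\blacktriangleleft,\blacktriangleright$ such that, with $x\cdot y=x\blacktriangleright y+y\blacktriangleleft x$, $x\diamond y=x\blacktriangleright y+x\blacktriangleleft y$ and $x\circ y=x\cdot y+y\cdot x$, the following five expressions $J_1,\dots,J_5$ in $x,y,z,t$ vanish identically: \begin{align*} J_1={}&(x\circ y)\blacktriangleright(z\blacktriangleright t)+(y\circ z)\blacktriangleright(x\blacktriangleright t)+(z\circ x)\blacktriangleright(y\blacktriangleright t)\\&-x\blacktriangleright((y\circ z)\blacktriangleright t)-y\blacktriangleright((z\circ x)\blacktriangleright t)-z\blacktriangleright((x\circ y)\blacktriangleright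 t),\\ J_2={}&(x\circ y)\blacktriangleright(z\blacktriangleright t)+(y\circ z)\blacktriangleright(x\blacktriangleright t)+(z\circ x)\blacktriangleright(y\blacktriangleright t)\\&-x\blacktriangleright(y\blacktriangleright(z\blacktriangleright t))-z\blacktriangleright(y\blacktriangleright(x\blacktriangleright t))-(y\circ(z\circ x))\blacktriangleright t,\\ J_3={}&(x\circ y)\blacktriangleright(z\blacktriangleleft t)+(x\cdot z)\blacktriangleleft(y\diamond t)+(y\cdot z)\blacktriangleleft(x\diamond t)\\&-x\blacktriangleright(z\blacktriangleleft(y\diamond t))-y\blacktriangleright(z\blacktriangleleft(x\diamond t))-((x\circ y)\cdot z)\blacktriangleleft t,\\ J_4={}&(z\cdot y)\blacktriangleleft(x\diamond t)+(x\cdot y)\blacktriangleleft(z\diamond t)+(x\circ z)\blacktriangleright(y\blacktriangleleft t)\\&-x\blacktriangleright((z\cdot y)\blacktriangleleft t)-z\blacktriangleright((x\cdot y)\blacktriangleleft t)-y\blacktriangleleft((x\circ z)\diamond t),\\ J_5={}&(x\circ y)\blacktriangleright(z\blacktriangleleft t)+(x\cdot z)\blacktriangleleft(y\diamond t)+(y\cdot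 z)\blacktriangleleft(x\diamond t)\\&-x\blacktriangleright(y\blacktriangleright(z\blacktriangleleft t))-z\blacktriangleleft(y\diamond(x\diamond t))-(y\cdot(x\cdot z))\blacktriangleleft t. \end{align*} \textbf{Proposition.} (1) In every alternative quadrialgebra over $F$, the operations $x\blacktriangleleft y=x\nearrow y+y\swarrow x$ and $x\blacktriangleright y=x\searrow y+y\nwarrow x$ define a J-dendriform algebra. Let further $Y$ be a set with at least four elements, and let $Q$ be the free alternative quadrialgebra over $F$ on $Y$, with the two operations $\blacktriangleleft,\blacktriangleright$ of (1). (2) Suppose that $F$ has characteristic different from $2$. Let $f$ be a multilinear polynomial in $x_1,x_2,x_3,x_4$ in the free algebra with two bilinear operations. If $f=0$ is an identity of $(Q,\blacktriangleleft,\blacktriangleright)$, then $f$ is a linear combination of the polynomials $J_i(x_{\sigma(1)},x_{\sigma(2)},x_{\sigma(3)},x_{\sigma(4)})$ with $1\le i\le 5$ and $\sigma\in S_4$. (3) Suppose that $F$ has characteristic $0$. Let $f$ be a homogeneous polynomial of degree $4$, not necessarily multilinear, in the free algebra with two bilinear operations on any set $X$ of variables. If $f=0$ is an identity of $(Q,\blacktriangleleft,\blacktriangleright)$,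 then $f$ lies in the T-ideal of the J-dendriform identities, that is, in the ideal generated by all values of $J_1,\dots,J_5$ in that free algebra. -/

import Mathlib

/-! ### Algebras with a family of bilinear operations -/

/-- A family of bilinear operations on `A`, indexed by `Ω`. -/
abbrev BilinOps (F Ω A : Type*) [Field F] [AddCommGroup A] [Module F A] :=
  Ω → A →ₗ[F] A →ₗ[F] A

/-- Nonassociative monomials in variables from `X`, with operation symbols from `Ω`. -/
inductive OpTree (Ω X : Type*)
  | var : X → OpTree Ω X
  | node : Ω → OpTree Ω X → OpTree Ω X → OpTree Ω X

/-- The multiset of the variables of a monomial, counted with multiplicity. -/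
def OpTree.leaves {Ω X : Type*} : OpTree Ω X → Multiset X
  | .var x => {x}
  | .node _ s t => s.leaves + t.leaves

/-- The value of a monomial under a substitution of elements of `A` for its variables. -/
def OpTree.eval {F Ω A X : Type*} [Field F] [AddCommGroup A] [Module F A]
    (m : BilinOps F Ω A) (a : X → A) : OpTree Ω X → A
  | .var x => a x
  | .node o s t => m o (s.eval m a) (t.eval m a)

/-- The free `Ω`-algebra on `X` over `F`: the space of nonassociative polynomials. -/
abbrev FreeOpAlg (F Ω X : Type*) [Field F] := OpTree Ω X →₀ F

namespace FreeOpAlg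

variable {F Ω X : Type*} [Field F]

/-- The generators of the free algebra. -/
noncomputable def var (F Ω : Type*) {X : Type*} [Field F] (x : X) : FreeOpAlg F Ω X :=
  Finsupp.single (OpTree.var x) 1

/-- The operations of the free algebra: bilinear extensions of the formation of trees. -/
noncomputable def ops (F Ω X : Type*) [Field F] : BilinOps F Ω (FreeOpAlg F Ω X) :=
  fun o => Finsupp.linearCombination F
    (fun s => Finsupp.lmapDomain F F (fun t => OpTree.node o s t))

/-- The value of a polynomial under a substitution of elements of `A` for its variables. -/
noncomputable def eval {A : Type*} [AddCommGroup A] [Module F A]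
    (m : BilinOps F Ω A) (a : X → A) : FreeOpAlg F Ω X →ₗ[F] A :=
  Finsupp.linearCombination F (fun t => t.eval m a)

/-- `f = 0` is a polynomial identity of the algebra `(A, m)`. -/
def IsIdentity {A : Type*} [AddCommGroup A] [Module F A]
    (m : BilinOps F Ω A) (f : FreeOpAlg F Ω X) : Prop :=
  ∀ a : X → A, eval m a f = 0

/-- `f` is homogeneous of (total) degree `d`. -/
def IsHomogeneous (d : ℕ) (f : FreeOpAlg F Ω X) : Prop :=
  ∀ t ∈ f.support, Multiset.card t.leaves = d

/-- `f` is multilinear: each of the variables occurs exactly once in each monomial of `f`. -/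
def IsMultilinear [Fintype X] (f : FreeOpAlg F Ω X) : Prop :=
  ∀ t ∈ f.support, t.leaves = (Finset.univ : Finset X).val

end FreeOpAlg

/-- The two-sided ideal of the algebra `(A, m)` generated by `S`. -/
def opIdeal {F Ω A : Type*} [Field F] [AddCommGroup A] [Module F A]
    (m : BilinOps F Ω A) (S : Set A) : Submodule F A :=
  sInf {I | S ⊆ I ∧ ∀ (o : Ω) (a b : A), b ∈ I → m o a b ∈ I ∧ m o b a ∈ I}

theorem opIdeal_mul_mem {F Ω A : Type*} [Field F] [AddCommGroup A] [Module F A]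
    (m : BilinOps F Ω A) (S : Set A) (o : Ω) (a b : A) (hb : b ∈ opIdeal m S) :
    m o a b ∈ opIdeal m S ∧ m o b a ∈ opIdeal m S := by
  simp only [opIdeal, Submodule.mem_sInf] at hb ⊢
  exact ⟨fun I hI => (hI.2 o a b (hb I hI)).1, fun I hI => (hI.2 o a b (hb I hI)).2⟩

/-- The operations induced on the quotient by an ideal:
`m o (class of a) (class of b) = class of (m o a b)`. -/
noncomputable def quotientOps {F Ω A : Type*} [Field F] [AddCommGroup A] [Module F A]
    (m : BilinOps F Ω A) (S : Set A) : BilinOps F Ω (A ⧸ opIdeal m S) :=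
  fun o => (opIdeal m S).liftQ
    { toFun := fun a => (opIdeal m S).mapQ (opIdeal m S) (m o a)
        (fun b hb => (opIdeal_mul_mem m S o a b hb).1)
      map_add' := fun a a' => by ext b; simp
      map_smul' := fun c a => by ext b; simp }
    (fun b hb => by
      rw [LinearMap.mem_ker]
      ext a
      simpa using (opIdeal_mul_mem m S o a b hb).2)

/-! ### Alternative quadrialgebras -/

/-- The four operation symbols `↗`, `↘`, `↙`, `↖` of a quadrialgebra. -/
inductive QuadOp
  | ne | se | sw | nw

namespace Quad

variable {F A : Type*} [Field F] [AddCommGroup A] [Module F A] (m : BilinOps F QuadOp A)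

/-- The sum operation `x ≻ y = x ↗ y + x ↘ y`. -/
def succ (x y : A) : A := m .ne x y + m .se x y

/-- The sum operation `x ≺ y = x ↖ y + x ↙ y`. -/
def prec (x y : A) : A := m .nw x y + m .sw x y

/-- The sum operation `x ∨ y = x ↘ y + x ↙ y`. -/
def vee (x y : A) : A := m .se x y + m .sw x y

/-- The sum operation `x ∧ y = x ↗ y + x ↖ y`. -/
def wedge (x y : A) : A := m .ne x y + m .nw x y

/-- The sum `x * y` of all four operations. -/
def star (x y : A) : A := succ m x y + prec m x y

/-- right associator -/
def assocR (x y z : A) : A := m .nw (m .nw x y) z - m .nw x (star m y z)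

/-- left associator -/
def assocL (x y z : A) : A := m .se (star m x y) z - m .se x (m .se y z)

/-- north-east associator -/
def assocNE (x y z : A) : A := m .ne (wedge m x y) z - m .ne x (succ m y z)

/-- south-west associator -/
def assocSW (x y z : A) : A := m .sw (prec m x y) z - m .sw x (vee m y z)

/-- north associator -/
def assocN (x y z : A) : A := m .nw (m .ne x y) z - m .ne x (prec m y z)

/-- west associator -/
def assocW (x y z : A) : A := m .nw (m .sw x y) z - m .sw x (wedge m y z)

/-- south associator -/
def assocS (x y z : A) : A := m .sw (succ m x y) z - m .se x (m .sw y z)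

/-- east associator -/
def assocE (x y z : A) : A := m .ne (vee m x y) z - m .se x (m .ne y z)

/-- middle associator -/
def assocM (x y z : A) : A := m .nw (m .se x y) z - m .se x (m .nw y z)

/-- The left-hand sides of the nine defining identities of alternative quadrialgebras. -/
def identity (x y z : A) : Fin 9 → A :=
  ![assocR m x y z + assocM m y x z,
    assocR m x y z + assocR m x z y,
    assocN m x y z + assocW m y x z,
    assocN m x y z + assocNE m x z y,
    assocNE m x y z + assocE m y x z,
    assocW m x y z + assocSW m x z y,
    assocSW m x y z + assocS m y x z,
    assocM m x y z + assocL m x z y,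
    assocL m x y z + assocL m y x z]

end Quad

/-- `(A, m)` is an alternative quadrialgebra. -/
def IsAlternativeQuadrialgebra {F A : Type*} [Field F] [AddCommGroup A] [Module F A]
    (m : BilinOps F QuadOp A) : Prop :=
  ∀ (x y z : A) (i : Fin 9), Quad.identity m x y z i = 0

/-- All values of the defining identities of alternative quadrialgebras in the free algebra with
four bilinear operations on `Y`. -/
def quadRelations (F Y : Type*) [Field F] : Set (FreeOpAlg F QuadOp Y) :=
  {r | ∃ x y z i, r = Quad.identity (FreeOpAlg.ops F QuadOp Y) x y z i}

/-- The free alternative quadrialgebra on `Y`. -/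
noncomputable abbrev FreeAltQuad (F Y : Type*) [Field F] :=
  FreeOpAlg F QuadOp Y ⧸ opIdeal (FreeOpAlg.ops F QuadOp Y) (quadRelations F Y)

/-- The operations of the free alternative quadrialgebra on `Y`. -/
noncomputable def FreeAltQuad.ops (F Y : Type*) [Field F] :
    BilinOps F QuadOp (FreeAltQuad F Y) :=
  quotientOps (FreeOpAlg.ops F QuadOp Y) (quadRelations F Y)

/-! ### J-dendriform algebras -/

/-- The two operation symbols `◀` and `▶`. -/
inductive JOp
  | left | right

namespace JDend

variable {F A : Type*} [Field F] [AddCommGroup A] [Module F A] (m : BilinOps F JOp A)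

local notation x:70 " ◀ " y:71 => m JOp.left x y
local notation x:70 " ▶ " y:71 => m JOp.right x y

/-- `x · y = x ▶ y + y ◀ x`. -/
def dot (x y : A) : A := x ▶ y + y ◀ x

/-- `x ⋄ y = x ▶ y + x ◀ y`. -/
def diam (x y : A) : A := x ▶ y + x ◀ y

/-- `x ∘ y = x · y + y · x`. -/
def circ (x y : A) : A := dot m x y + dot m y x

local notation x:70 " ⬝ " y:71 => dot m x y
local notation x:70 " ⋄ " y:71 => diam m x y
local notation x:70 " ⊚ " y:71 => circ m x y

/-- The left-hand sides of the five defining identities of J-dendriform algebras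
(here `⊚` is the product `circ`). -/
def identity (x y z t : A) : Fin 5 → A :=
  ![(x ⊚ y) ▶ (z ▶ t) + (y ⊚ z) ▶ (x ▶ t) + (z ⊚ x) ▶ (y ▶ t)
      - x ▶ ((y ⊚ z) ▶ t) - y ▶ ((z ⊚ x) ▶ t) - z ▶ ((x ⊚ y) ▶ t),
    (x ⊚ y) ▶ (z ▶ t) + (y ⊚ z) ▶ (x ▶ t) + (z ⊚ x) ▶ (y ▶ t)
      - x ▶ (y ▶ (z ▶ t)) - z ▶ (y ▶ (x ▶ t)) - (y ⊚ (z ⊚ x)) ▶ t,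
    (x ⊚ y) ▶ (z ◀ t) + (x ⬝ z) ◀ (y ⋄ t) + (y ⬝ z) ◀ (x ⋄ t)
      - x ▶ (z ◀ (y ⋄ t)) - y ▶ (z ◀ (x ⋄ t)) - ((x ⊚ y) ⬝ z) ◀ t,
    (z ⬝ y) ◀ (x ⋄ t) + (x ⬝ y) ◀ (z ⋄ t) + (x ⊚ z) ▶ (y ◀ t)
      - x ▶ ((z ⬝ y) ◀ t) - z ▶ ((x ⬝ y) ◀ t) - y ◀ ((x ⊚ z) ⋄ t),
    (x ⊚ y) ▶ (z ◀ t) + (x ⬝ z) ◀ (y ⋄ t) + (y ⬝ z) ◀ (x ⋄ t)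
      - x ▶ (y ▶ (z ◀ t)) - z ◀ (y ⋄ (x ⋄ t)) - (y ⬝ (x ⬝ z)) ◀ t]

end JDend

/-- `(A, m)` is a J-dendriform algebra. -/
def IsJDendriform {F A : Type*} [Field F] [AddCommGroup A] [Module F A]
    (m : BilinOps F JOp A) : Prop :=
  ∀ (x y z t : A) (i : Fin 5), JDend.identity m x y z t i = 0

/-- The T-ideal of the J-dendriform identities: the ideal of the free algebra with two bilinear
operations on `X` that is generated by all values of the J-dendriform identities. -/
noncomputable def jDendTIdeal (F X : Type*) [Field F] : Submodule F (FreeOpAlg F JOp X) :=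
  opIdeal (FreeOpAlg.ops F JOp X)
    {r | ∃ x y z t i, r = JDend.identity (FreeOpAlg.ops F JOp X) x y z t i}

/-- The operations `x ◀ y = x ↗ y + y ↙ x` and `x ▶ y = x ↘ y + y ↖ x`. -/
noncomputable def quadToJ {F A : Type*} [Field F] [AddCommGroup A] [Module F A]
    (m : BilinOps F QuadOp A) : BilinOps F JOp A
  | .left => m .ne + (m .sw).flip
  | .right => m .se + (m .nw).flip

/-! For (1), each `J_i` evaluated in a quadrialgebra is written explicitly as a sum of values of the
defining identities, some multiplied by a further element (`Quad.jIdentity_0_eq` and its four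
companions).

For the converse, identities are tested on concrete quadrialgebras. Two injective rankings of the
positions split the product of strictly upper triangular matrices into four pieces, according to
which factor's interval contains the position of highest rank for each ranking; all nine associators
of the resulting structure vanish. Substituting matrix units along a word of length four, the corner
entry of the value of `f` is the sum of five coefficients of `f`, one per bracketing of the word,
each bracketing being turned into a monomial by the two rankings (`eval_wordSubst`). The product of
ranked monomials used there is commutative, so up to orientation only combs `((a b) t) x` and
balanced trees `(a b) (t x)` occur.

Comparing the relations for different words and dividing by 2 shows that, for fixed rankings, the
coefficient at a comb depends only on its third letter `t`, and that the coefficients at balanced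
trees are determined by those at combs (`RankedTree.comb_swap_outer`, `RankedTree.balanced_eq`). An
oriented comb depends on a ranking only through three comparisons, so rankings can be exchanged as
well, until only the letters `l` and `l'` of highest rank for the two rankings matter
(`exists_refComb_eq`). A multilinear solution is therefore determined by 64 coefficients, indexed by
`(t, l, l')`. By (1) the `J_i` are solutions too, and 64 instances of them have minus the identity
matrix as their matrix of reference coefficients (`jCoeff_refComb`). Hence they span all multilinear
solutions, which is (2).

For (3), the relations hold for words with repeated letters as well, so every linearization of `f`
falls under the multilinear argument. Substituting back and summing gives `24 f`. -/

namespace JDend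

variable {F A : Type*} [Field F] [AddCommGroup A] [Module F A] (m : BilinOps F JOp A) (x y z t : A)

theorem identity_0 : identity m x y z t 0 =
    m .right (circ m x y) (m .right z t) + m .right (circ m y z) (m .right x t) +
      m .right (circ m z x) (m .right y t) - m .right x (m .right (circ m y z) t) -
      m .right y (m .right (circ m z x) t) - m .right z (m .right (circ m x y) t) := rfl

theorem identity_1 : identity m x y z t 1 =
    m .right (circ m x y) (m .right z t) + m .right (circ m y z) (m .right x t) +
      m .right (circ m z x) (m .right y t) - m .right x (m .right y (m .right z t)) -
      m .right z (m .right y (m .right x t)) - m .right (circ m y (circ m z x)) t := rfl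

theorem identity_2 : identity m x y z t 2 =
    m .right (circ m x y) (m .left z t) + m .left (dot m x z) (diam m y t) +
      m .left (dot m y z) (diam m x t) - m .right x (m .left z (diam m y t)) -
      m .right y (m .left z (diam m x t)) - m .left (dot m (circ m x y) z) t := rfl

theorem identity_3 : identity m x y z t 3 =
    m .left (dot m z y) (diam m x t) + m .left (dot m x y) (diam m z t) +
      m .right (circ m x z) (m .left y t) - m .right x (m .left (dot m z y) t) -
      m .right z (m .left (dot m x y) t) - m .left y (diam m (circ m x z) t) := rfl

theorem identity_4 : identity m x y z t 4 =
    m .right (circ m x y) (m .left z t) + m .left (dot m x z) (diam m y t) +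
      m .left (dot m y z) (diam m x t) - m .right x (m .right y (m .left z t)) -
      m .left z (diam m y (diam m x t)) - m .left (dot m y (dot m x z)) t := rfl

end JDend

/-! ### The J-dendriform expressions as consequences of the quadrialgebra identities. -/

namespace Quad

section

variable {F A : Type*} [Field F] [AddCommGroup A] [Module F A] (m : BilinOps F QuadOp A) (x y z : A)

theorem identity_0 : identity m x y z 0 = assocR m x y z + assocM m y x z := rfl

theorem identity_2 : identity m x y z 2 = assocN m x y z + assocW m y x z := rfl

theorem identity_4 : identity m x y z 4 = assocNE m x y z + assocE m y x z := rfl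

theorem identity_6 : identity m x y z 6 = assocSW m x y z + assocS m y x z := rfl

theorem identity_8 : identity m x y z 8 = assocL m x y z + assocL m y x z := rfl

end

variable {F A : Type*} [Field F] [AddCommGroup A] [Module F A] {m : BilinOps F QuadOp A}

/-- The sum of the nine identities that together express left alternativity of `star`. -/
def leftAltStar (m : BilinOps F QuadOp A) (x y z : A) : A :=
  identity m x y z 0 + identity m y x z 0 + identity m x y z 2 + identity m y x z 2 +
  identity m x y z 4 + identity m y x z 4 + identity m x y z 6 + identity m y x z 6 +
  identity m x y z 8

-- In quadrialgebra terms `x · y = x ∨ y + y ∧ x`, `x ⋄ y = x ≻ y + y ≺ x` and `x ∘ y = x * y + y *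
-- x`. This and the next four certificates are built from the five identities of even index, those
-- that exchange the first two arguments of an associator; after expansion both sides agree in the
-- free abelian group on monomials.
set_option maxHeartbeats 1000000 in
theorem jIdentity_0_eq (x y z t : A) : JDend.identity (quadToJ m) x y z t 0 =
      identity m t z (star m x y) 0 - identity m t (star m x y) z 0 + identity m t z (star m y
      x) 0 - identity m t (star m y x) z 0 + identity m x y (m .se z t) 8 - m .nw t
      (leftAltStar m x y z) - m .se z (identity m x y t 8) + identity m t x (star m y z) 0 -
      identity m t (star m y z) x 0 + identity m t x (star m z y) 0 - identity m t (star m z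
      y) x 0 + identity m y z (m .se x t) 8 - m .nw t (leftAltStar m y z x) - m .se x
      (identity m y z t 8) + identity m t y (star m z x) 0 - identity m t (star m z x) y 0 +
      identity m t y (star m x z) 0 - identity m t (star m x z) y 0 + identity m z x (m .se y
      t) 8 - m .nw t (leftAltStar m z x y) - m .se y (identity m z x t 8) := by
  simp only [JDend.identity_0, JDend.circ, JDend.dot, quadToJ, leftAltStar, identity_0,
    identity_2, identity_4, identity_6, identity_8, assocR, assocL, assocNE, assocSW, assocN,
    assocW, assocS, assocE, assocM, star, succ, prec, vee, wedge, map_add, map_sub,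
    LinearMap.add_apply, LinearMap.flip_apply]
  abel

set_option maxHeartbeats 1000000 in
theorem jIdentity_1_eq (x y z t : A) : JDend.identity (quadToJ m) x y z t 1 =
      identity m t y (star m x z) 0 - identity m (star m x z) y t 8 + identity m t y (star m z
      x) 0 - identity m (star m z x) y t 8 + identity m x z (m .nw t y) 8 - m .se y (identity
      m x z t 8) - m .nw t (leftAltStar m x z y) + identity m y x (m .se z t) 8 - identity m
      (m .se z t) y x 0 + identity m y x (m .nw t z) 8 - identity m (m .nw t z) y x 0 +
      identity m t z (star m x y) 0 - m .se y (identity m t z x 0) - m .se x (identity m t z y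
      0) + identity m y z (m .nw t x) 8 - identity m (m .nw t x) y z 0 + identity m y z (m .se
      x t) 8 - identity m (m .se x t) y z 0 + identity m t x (star m z y) 0 - m .se y
      (identity m t x z 0) - m .se z (identity m t x y 0) := by
  simp only [JDend.identity_1, JDend.circ, JDend.dot, quadToJ, leftAltStar, identity_0,
    identity_2, identity_4, identity_6, identity_8, assocR, assocL, assocNE, assocSW, assocN,
    assocW, assocS, assocE, assocM, star, succ, prec, vee, wedge, map_add, map_sub,
    LinearMap.add_apply, LinearMap.flip_apply]
  abel

set_option maxHeartbeats 1000000 in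
theorem jIdentity_2_eq (x y z t : A) : JDend.identity (quadToJ m) x y z t 2 =
      identity m z t (star m x y) 2 - identity m z (star m x y) t 4 + identity m z t (star m y
      x) 2 - identity m z (star m y x) t 4 + identity m x y (m .sw t z) 8 - m .ne z (identity
      m x y t 4) - m .ne z (identity m y x t 4) - m .ne z (identity m x y t 8) - m .sw t
      (identity m x y z 6) - m .sw t (identity m y x z 6) - m .sw t (identity m x y z 8) +
      identity m z x (succ m y t) 4 - identity m z (succ m y t) x 2 + identity m z x (prec m t
      y) 4 - identity m z (prec m t y) x 2 + identity m t y (vee m x z) 6 - m .ne z (identity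
      m y t x 2) - m .ne z (identity m t y x 0) - m .ne z (identity m t y x 6) - m .se x
      (identity m t y z 6) + identity m z y (prec m t x) 4 - identity m z (prec m t x) y 2 +
      identity m z y (succ m x t) 4 - identity m z (succ m x t) y 2 + identity m t x (vee m y
      z) 6 - m .ne z (identity m t x y 0) - m .ne z (identity m x t y 2) - m .ne z (identity m
      t x y 6) - m .se y (identity m t x z 6) := by
  simp only [JDend.identity_2, JDend.circ, JDend.dot, JDend.diam, quadToJ, identity_0,
    identity_2, identity_4, identity_6, identity_8, assocR, assocL, assocNE, assocSW, assocN,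
    assocW, assocS, assocE, assocM, star, succ, prec, vee, wedge, map_add, map_sub,
    LinearMap.add_apply, LinearMap.flip_apply]
  abel

set_option maxHeartbeats 1000000 in
theorem jIdentity_3_eq (x y z t : A) : JDend.identity (quadToJ m) x y z t 3 =
      identity m t z (vee m x y) 6 - identity m (vee m x y) t z 2 + identity m t z (wedge m y
      x) 6 - identity m (wedge m y x) t z 2 + identity m y x (succ m z t) 4 - m .sw t
      (identity m y x z 2) - m .sw t (identity m y x z 0) - m .sw t (identity m y x z 4) - m
      .se z (identity m y x t 4) + identity m t x (wedge m y z) 6 - identity m (wedge m y z) t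
      x 2 + identity m t x (vee m z y) 6 - identity m (vee m z y) t x 2 + identity m y z (succ
      m x t) 4 - m .sw t (identity m y z x 0) - m .sw t (identity m y z x 2) - m .sw t
      (identity m y z x 4) - m .se x (identity m y z t 4) + identity m y t (star m z x) 2 -
      identity m t (star m z x) y 6 + identity m y t (star m x z) 2 - identity m t (star m x
      z) y 6 + identity m z x (m .ne y t) 8 - m .sw t (identity m z x y 6) - m .sw t (identity
      m x z y 6) - m .sw t (identity m z x y 8) - m .ne y (identity m z x t 4) - m .ne y
      (identity m x z t 4) - m .ne y (identity m z x t 8) := by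
  simp only [JDend.identity_3, JDend.circ, JDend.dot, JDend.diam, quadToJ, identity_0,
    identity_2, identity_4, identity_6, identity_8, assocR, assocL, assocNE, assocSW, assocN,
    assocW, assocS, assocE, assocM, star, succ, prec, vee, wedge, map_add, map_sub,
    LinearMap.add_apply, LinearMap.flip_apply]
  abel

set_option maxHeartbeats 1000000 in
theorem jIdentity_4_eq (x y z t : A) : JDend.identity (quadToJ m) x y z t 4 =
      identity m t y (vee m x z) 6 - identity m (vee m x z) y t 4 + identity m t y (wedge m z
      x) 6 - identity m (wedge m z x) y t 4 + identity m z x (prec m t y) 4 - m .se y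
      (identity m z x t 4) - m .sw t (identity m z x y 2) - m .sw t (identity m z x y 0) - m
      .sw t (identity m z x y 4) + identity m y x (m .ne z t) 8 - identity m (m .ne z t) y x 0
      + identity m y x (m .sw t z) 8 - identity m (m .sw t z) y x 0 + identity m z t (star m x
      y) 2 - m .se y (identity m z t x 2) - m .se x (identity m z t y 2) + identity m z y
      (prec m t x) 4 - identity m (prec m t x) y z 6 + identity m z y (succ m x t) 4 -
      identity m (succ m x t) y z 6 + identity m t x (wedge m z y) 6 - m .se y (identity m t x
      z 6) - m .ne z (identity m t x y 0) - m .ne z (identity m x t y 2) - m .ne z (identity m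
      t x y 6) := by
  simp only [JDend.identity_4, JDend.circ, JDend.dot, JDend.diam, quadToJ, identity_0,
    identity_2, identity_4, identity_6, identity_8, assocR, assocL, assocNE, assocSW, assocN,
    assocW, assocS, assocE, assocM, star, succ, prec, vee, wedge, map_add, map_sub,
    LinearMap.add_apply, LinearMap.flip_apply]
  abel

end Quad

theorem IsAlternativeQuadrialgebra.isJDendriform {F A : Type*} [Field F] [AddCommGroup A]
    [Module F A] {m : BilinOps F QuadOp A} (h : IsAlternativeQuadrialgebra m) :
    IsJDendriform (quadToJ m) := by
  have h' : ∀ x y z i, Quad.identity m x y z i = 0 := h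
  intro x y z t i
  fin_cases i
  · exact (Quad.jIdentity_0_eq x y z t).trans (by simp [Quad.leftAltStar, h'])
  · exact (Quad.jIdentity_1_eq x y z t).trans (by simp [Quad.leftAltStar, h'])
  · exact (Quad.jIdentity_2_eq x y z t).trans (by simp [h'])
  · exact (Quad.jIdentity_3_eq x y z t).trans (by simp [h'])
  · exact (Quad.jIdentity_4_eq x y z t).trans (by simp [h'])

/-! ### A family of quadrialgebras of strictly upper triangular matrices -/

/-- The largest rank of a position in the interval `[i, j)`. -/
def maxRank (ρ : ℕ → ℕ) (i j : ℕ) : ℕ := (Finset.Ico i j).sup ρ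

theorem maxRank_eq_max (ρ : ℕ → ℕ) {i j k : ℕ} (hij : i < j) (hjk : j < k) :
    maxRank ρ i k = max (maxRank ρ i j) (maxRank ρ j k) := by
  rw [maxRank, ← Finset.Ico_union_Ico_eq_Ico hij.le hjk.le, Finset.sup_union]
  rfl

theorem maxRank_succ (ρ : ℕ → ℕ) (i : ℕ) : maxRank ρ i (i + 1) = ρ i := by
  simp [maxRank]

theorem exists_maxRank_eq (ρ : ℕ → ℕ) {i j : ℕ} (h : i < j) :
    ∃ n, i ≤ n ∧ n < j ∧ maxRank ρ i j = ρ n := by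
  obtain ⟨n, hn, e⟩ := Finset.exists_mem_eq_sup (Finset.Ico i j) ⟨i, by simp [h]⟩ ρ
  rw [Finset.mem_Ico] at hn
  exact ⟨n, hn.1, hn.2, e⟩

theorem maxRank_ne {ρ : ℕ → ℕ} (hρ : Function.Injective ρ) {i j k : ℕ} (hij : i < j)
    (hjk : j < k) : maxRank ρ i j ≠ maxRank ρ j k := by
  obtain ⟨n, -, hn, e⟩ := exists_maxRank_eq ρ hij
  obtain ⟨n', hn', -, e'⟩ := exists_maxRank_eq ρ hjk
  intro h
  have := hρ (e.symm.trans (h.trans e'))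
  omega

section Weights

variable (F : Type*) [Field F] (ρ : ℕ → ℕ)

/-- The indicator of the highest rank of `[i, k)` lying in `[j, k)`. -/
def rightWt (i j k : ℕ) : F := if maxRank ρ i j < maxRank ρ j k then 1 else 0

/-- The indicator of the highest rank of `[i, k)` lying in `[i, j)`. -/
def leftWt (i j k : ℕ) : F := if maxRank ρ i j < maxRank ρ j k then 0 else 1

theorem leftWt_eq (i j k : ℕ) : leftWt F ρ i j k = 1 - rightWt F ρ i j k := by
  unfold rightWt leftWt
  split_ifs <;> simp

variable {ρ} (hρ : Function.Injective ρ) {i j k l : ℕ} (hij : i < j) (hjk : j < k) (hkl : k < l)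
include hρ hij hjk hkl

/-- For `i < j < k < l` the position of highest rank in `[i, l)` lies in exactly one of `[i, j)`,
`[j, k)`, `[k, l)`. Both sides of this lemma and of the next two indicate the first, second and
third case respectively. They are the three dendriform axioms at the level of weights; injectivity
of the ranking excludes ties. -/
theorem leftWt_mul_leftWt : leftWt F ρ i j k * leftWt F ρ i k l = leftWt F ρ i j l := by
  have h1 := maxRank_ne hρ hij hjk
  have h2 := maxRank_ne hρ hjk hkl
  unfold leftWt
  rw [maxRank_eq_max ρ hij hjk, maxRank_eq_max ρ hjk hkl]
  split_ifs <;> first | (exfalso; omega) | simp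

theorem rightWt_mul_leftWt :
    rightWt F ρ i j k * leftWt F ρ i k l = rightWt F ρ i j l * leftWt F ρ j k l := by
  have h1 := maxRank_ne hρ hij hjk
  have h2 := maxRank_ne hρ hjk hkl
  unfold leftWt rightWt
  rw [maxRank_eq_max ρ hij hjk, maxRank_eq_max ρ hjk hkl]
  split_ifs <;> first | (exfalso; omega) | simp

theorem rightWt_eq_mul : rightWt F ρ i k l = rightWt F ρ i j l * rightWt F ρ j k l := by
  have h1 := maxRank_ne hρ hij hjk
  have h2 := maxRank_ne hρ hjk hkl
  unfold rightWt
  rw [maxRank_eq_max ρ hij hjk, maxRank_eq_max ρ hjk hkl]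
  split_ifs <;> first | (exfalso; omega) | simp

end Weights

section WeightedProduct

variable {F : Type*} [Field F]

/-- The product of strictly upper triangular matrices with weights. -/
def weightedMul (W : ℕ → ℕ → ℕ → F) : (ℕ → ℕ → F) →ₗ[F] (ℕ → ℕ → F) →ₗ[F] (ℕ → ℕ → F) :=
  LinearMap.mk₂ F (fun x y i k => ∑ j ∈ Finset.Ioo i k, W i j k * (x i j * y j k))
    (fun x x' y => by
      ext i k
      simp only [Pi.add_apply, ← Finset.sum_add_distrib]
      exact Finset.sum_congr rfl fun j _ => by ring)
    (fun c x y => by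
      ext i k
      simp only [Pi.smul_apply, smul_eq_mul, Finset.mul_sum]
      exact Finset.sum_congr rfl fun j _ => by ring)
    (fun x y y' => by
      ext i k
      simp only [Pi.add_apply, ← Finset.sum_add_distrib]
      exact Finset.sum_congr rfl fun j _ => by ring)
    (fun c x y => by
      ext i k
      simp only [Pi.smul_apply, smul_eq_mul, Finset.mul_sum]
      exact Finset.sum_congr rfl fun j _ => by ring)

theorem weightedMul_apply (W : ℕ → ℕ → ℕ → F) (x y : ℕ → ℕ → F) (i k : ℕ) :
    weightedMul W x y i k = ∑ j ∈ Finset.Ioo i k, W i j k * (x i j * y j k) := rfl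

theorem weightedMul_add (W W' : ℕ → ℕ → ℕ → F) (x y : ℕ → ℕ → F) :
    weightedMul W x y + weightedMul W' x y = weightedMul (W + W') x y := by
  ext i k
  simp only [Pi.add_apply, weightedMul_apply, ← Finset.sum_add_distrib]
  exact Finset.sum_congr rfl fun j _ => by ring

/-- Both iterated products are sums over `i < j < k < l` of the same entries, so an associativity
law only has to be checked on the weights. -/
theorem weightedMul_assoc {P Q R S : ℕ → ℕ → ℕ → F}
    (h : ∀ i j k l, i < j → j < k → k < l → P i j k * Q i k l = R i j l * S j k l)
    (x y z : ℕ → ℕ → F) :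
    weightedMul Q (weightedMul P x y) z - weightedMul R x (weightedMul S y z) = 0 := by
  rw [sub_eq_zero]
  ext i l
  simp only [weightedMul_apply, Finset.mul_sum, Finset.sum_mul]
  rw [Finset.sum_comm' (s' := fun j => Finset.Ioo j l) (t' := Finset.Ioo i l)]
  · refine Finset.sum_congr rfl fun j hj => Finset.sum_congr rfl fun k hk => ?_
    rw [Finset.mem_Ioo] at hj hk
    linear_combination (x i j * y j k * z k l) * h i j k l hj.1 hk.1 hk.2
  · intro k j
    simp only [Finset.mem_Ioo]
    omega

/-- The quadrialgebra of strictly upper triangular matrices whose four products are the parts of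
the matrix product that are selected by two rankings of the positions. -/
def rankOps (F : Type*) [Field F] (ρ₁ ρ₂ : ℕ → ℕ) : BilinOps F QuadOp (ℕ → ℕ → F)
  | .se => weightedMul fun i j k => rightWt F ρ₁ i j k * rightWt F ρ₂ i j k
  | .ne => weightedMul fun i j k => rightWt F ρ₁ i j k * leftWt F ρ₂ i j k
  | .sw => weightedMul fun i j k => leftWt F ρ₁ i j k * rightWt F ρ₂ i j k
  | .nw => weightedMul fun i j k => leftWt F ρ₁ i j k * leftWt F ρ₂ i j k

/-- Every weight is a factor for `ρ₁` times a factor for `ρ₂`, and summing two of the operations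
removes one factor because the two indicators add up to 1. Each associator condition is thus the
product of one dendriform law for each ranking, and all nine associators vanish separately. -/
theorem isAlternativeQuadrialgebra_rankOps {ρ₁ ρ₂ : ℕ → ℕ} (h₁ : Function.Injective ρ₁)
    (h₂ : Function.Injective ρ₂) : IsAlternativeQuadrialgebra (rankOps F ρ₁ ρ₂) := by
  have key : ∀ i j k l, i < j → j < k → k < l → ∀ ρ, Function.Injective ρ →
      (1 - rightWt F ρ i j k) * (1 - rightWt F ρ i k l) = 1 - rightWt F ρ i j l ∧
      rightWt F ρ i j k * (1 - rightWt F ρ i k l) =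
        rightWt F ρ i j l * (1 - rightWt F ρ j k l) ∧
      rightWt F ρ i k l = rightWt F ρ i j l * rightWt F ρ j k l := by
    intro i j k l hij hjk hkl ρ hρ
    simp only [← leftWt_eq]
    exact ⟨leftWt_mul_leftWt F hρ hij hjk hkl, rightWt_mul_leftWt F hρ hij hjk hkl,
      rightWt_eq_mul F hρ hij hjk hkl⟩
  have hR : ∀ x y z, Quad.assocR (rankOps F ρ₁ ρ₂) x y z = 0 := fun x y z => by
    simp only [Quad.assocR, Quad.star, Quad.succ, Quad.prec, rankOps, weightedMul_add]
    refine weightedMul_assoc (fun i j k l hij hjk hkl => ?_) x y z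
    have e₁ := key i j k l hij hjk hkl ρ₁ h₁
    have e₂ := key i j k l hij hjk hkl ρ₂ h₂
    simp only [Pi.add_apply, leftWt_eq]
    -- Two equations `a₁ = b₁` and `a₂ = b₂` are multiplied through `a₁ a₂ - b₁ b₂ = a₂ (a₁ - b₁) +
    -- b₁ (a₂ - b₂)`; the other eight cases follow the same pattern.
    linear_combination ((1 - rightWt F ρ₂ i j k) * (1 - rightWt F ρ₂ i k l)) * e₁.1 +
      ((1 - rightWt F ρ₁ i j l)) * e₂.1
  have hL : ∀ x y z, Quad.assocL (rankOps F ρ₁ ρ₂) x y z = 0 := fun x y z => by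
    simp only [Quad.assocL, Quad.star, Quad.succ, Quad.prec, rankOps, weightedMul_add]
    refine weightedMul_assoc (fun i j k l hij hjk hkl => ?_) x y z
    have e₁ := key i j k l hij hjk hkl ρ₁ h₁
    have e₂ := key i j k l hij hjk hkl ρ₂ h₂
    simp only [Pi.add_apply, leftWt_eq]
    linear_combination (rightWt F ρ₂ i k l) * e₁.2.2 +
      (rightWt F ρ₁ i j l * rightWt F ρ₁ j k l) * e₂.2.2
  have hM : ∀ x y z, Quad.assocM (rankOps F ρ₁ ρ₂) x y z = 0 := fun x y z => by
    simp only [Quad.assocM, rankOps]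
    refine weightedMul_assoc (fun i j k l hij hjk hkl => ?_) x y z
    have e₁ := key i j k l hij hjk hkl ρ₁ h₁
    have e₂ := key i j k l hij hjk hkl ρ₂ h₂
    simp only [leftWt_eq]
    linear_combination (rightWt F ρ₂ i j k * (1 - rightWt F ρ₂ i k l)) * e₁.2.1 +
      (rightWt F ρ₁ i j l * (1 - rightWt F ρ₁ j k l)) * e₂.2.1
  have hNE : ∀ x y z, Quad.assocNE (rankOps F ρ₁ ρ₂) x y z = 0 := fun x y z => by
    simp only [Quad.assocNE, Quad.wedge, Quad.succ, rankOps, weightedMul_add]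
    refine weightedMul_assoc (fun i j k l hij hjk hkl => ?_) x y z
    have e₁ := key i j k l hij hjk hkl ρ₁ h₁
    have e₂ := key i j k l hij hjk hkl ρ₂ h₂
    simp only [Pi.add_apply, leftWt_eq]
    linear_combination ((1 - rightWt F ρ₂ i j k) * (1 - rightWt F ρ₂ i k l)) * e₁.2.2 +
      (rightWt F ρ₁ i j l * rightWt F ρ₁ j k l) * e₂.1
  have hE : ∀ x y z, Quad.assocE (rankOps F ρ₁ ρ₂) x y z = 0 := fun x y z => by
    simp only [Quad.assocE, Quad.vee, rankOps, weightedMul_add]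
    refine weightedMul_assoc (fun i j k l hij hjk hkl => ?_) x y z
    have e₁ := key i j k l hij hjk hkl ρ₁ h₁
    have e₂ := key i j k l hij hjk hkl ρ₂ h₂
    simp only [Pi.add_apply, leftWt_eq]
    linear_combination (rightWt F ρ₂ i j k * (1 - rightWt F ρ₂ i k l)) * e₁.2.2 +
      (rightWt F ρ₁ i j l * rightWt F ρ₁ j k l) * e₂.2.1
  have hSW : ∀ x y z, Quad.assocSW (rankOps F ρ₁ ρ₂) x y z = 0 := fun x y z => by
    simp only [Quad.assocSW, Quad.prec, Quad.vee, rankOps, weightedMul_add]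
    refine weightedMul_assoc (fun i j k l hij hjk hkl => ?_) x y z
    have e₁ := key i j k l hij hjk hkl ρ₁ h₁
    have e₂ := key i j k l hij hjk hkl ρ₂ h₂
    simp only [Pi.add_apply, leftWt_eq]
    linear_combination (rightWt F ρ₂ i k l) * e₁.1 +
      ((1 - rightWt F ρ₁ i j l)) * e₂.2.2
  have hS : ∀ x y z, Quad.assocS (rankOps F ρ₁ ρ₂) x y z = 0 := fun x y z => by
    simp only [Quad.assocS, Quad.succ, rankOps, weightedMul_add]
    refine weightedMul_assoc (fun i j k l hij hjk hkl => ?_) x y z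
    have e₁ := key i j k l hij hjk hkl ρ₁ h₁
    have e₂ := key i j k l hij hjk hkl ρ₂ h₂
    simp only [Pi.add_apply, leftWt_eq]
    linear_combination (rightWt F ρ₂ i k l) * e₁.2.1 +
      (rightWt F ρ₁ i j l * (1 - rightWt F ρ₁ j k l)) * e₂.2.2
  have hN : ∀ x y z, Quad.assocN (rankOps F ρ₁ ρ₂) x y z = 0 := fun x y z => by
    simp only [Quad.assocN, Quad.prec, rankOps, weightedMul_add]
    refine weightedMul_assoc (fun i j k l hij hjk hkl => ?_) x y z
    have e₁ := key i j k l hij hjk hkl ρ₁ h₁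
    have e₂ := key i j k l hij hjk hkl ρ₂ h₂
    simp only [Pi.add_apply, leftWt_eq]
    linear_combination ((1 - rightWt F ρ₂ i j k) * (1 - rightWt F ρ₂ i k l)) * e₁.2.1 +
      (rightWt F ρ₁ i j l * (1 - rightWt F ρ₁ j k l)) * e₂.1
  have hW : ∀ x y z, Quad.assocW (rankOps F ρ₁ ρ₂) x y z = 0 := fun x y z => by
    simp only [Quad.assocW, Quad.wedge, rankOps, weightedMul_add]
    refine weightedMul_assoc (fun i j k l hij hjk hkl => ?_) x y z
    have e₁ := key i j k l hij hjk hkl ρ₁ h₁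
    have e₂ := key i j k l hij hjk hkl ρ₂ h₂
    simp only [Pi.add_apply, leftWt_eq]
    linear_combination (rightWt F ρ₂ i j k * (1 - rightWt F ρ₂ i k l)) * e₁.1 +
      ((1 - rightWt F ρ₁ i j l)) * e₂.2.1
  intro x y z i
  fin_cases i <;> simp [Quad.identity, hR, hL, hM, hNE, hE, hSW, hS, hN, hW]

end WeightedProduct

/-! ### Commutative bracketings of ranked monomials -/

/-- A monomial with two ranks. -/
abbrev RankedTree (X : Type*) := OpTree JOp X × ℕ × ℕ

namespace RankedTree

variable {X : Type*}

/-- The product of two ranked monomials: the operation symbol and the order of the factors are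
determined by the ranks. -/
def mul (A B : RankedTree X) : RankedTree X :=
  (if A.2.1 < B.2.1 then
      if A.2.2 < B.2.2 then .node .right A.1 B.1 else .node .left A.1 B.1
    else if A.2.2 < B.2.2 then .node .left B.1 A.1 else .node .right B.1 A.1,
    max A.2.1 B.2.1, max A.2.2 B.2.2)

/-- The factor of smaller first rank stands on the left, and the symbol is `.right` exactly when the
second ranks compare in the same direction. Neither rule refers to the order in which the factors
are given. -/
theorem mul_comm {A B : RankedTree X} (h₁ : A.2.1 ≠ B.2.1) (h₂ : A.2.2 ≠ B.2.2) :
    mul A B = mul B A := by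
  unfold mul
  rw [max_comm A.2.1, max_comm A.2.2]
  congr 1
  split_ifs <;> first | rfl | (exfalso; omega)

/-- The sum of the values of a function at the five bracketings of a product of four factors. -/
def bracketSum {F : Type*} [Field F] (c : OpTree JOp X → F) (A B C D : RankedTree X) : F :=
  c (mul A (mul B (mul C D))).1 + c (mul A (mul (mul B C) D)).1 + c (mul (mul A B) (mul C D)).1 +
    c (mul (mul A (mul B C)) D).1 + c (mul (mul (mul A B) C) D).1

end RankedTree

/-! ### Evaluation at matrix units as a count of bracketings. -/

section Evaluation

open RankedTree Classical

variable {F : Type*} [Field F] {X : Type*} (ρ₁ ρ₂ : ℕ → ℕ)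

/-- The matrix unit at `(i, i + 1)`. -/
def superdiag (F : Type*) [Field F] (i : ℕ) : ℕ → ℕ → F :=
  fun a b => if a = i ∧ b = i + 1 then 1 else 0

/-- The substitution under which the variable at the position `i < 4` of a word takes the value
`superdiag F i`. -/
noncomputable def wordSubst (F : Type*) [Field F] (w : ℕ → X) (x : X) : ℕ → ℕ → F :=
  ∑ i ∈ Finset.range 4, if w i = x then superdiag F i else 0

theorem wordSubst_succ (w : ℕ → X) (x : X) {i : ℕ} (hi : i < 4) :
    wordSubst F w x i (i + 1) = if OpTree.var (Ω := JOp) x = .var (w i) then 1 else 0 := by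
  simp only [wordSubst, Finset.sum_apply]
  rw [Finset.sum_eq_single_of_mem i (by simpa using hi)]
  · by_cases h : w i = x
    · simp [h, superdiag]
    · simp [h, Ne.symm h]
  · intro j _ hj
    split_ifs
    · simp [superdiag, hj.symm]
    · rfl

theorem wordSubst_of_ne (w : ℕ → X) (x : X) {i k : ℕ} (hk : k ≠ i + 1) :
    wordSubst F w x i k = 0 := by
  simp only [wordSubst, Finset.sum_apply]
  refine Finset.sum_eq_zero fun j _ => ?_
  split_ifs
  · simp only [superdiag, ite_eq_right_iff, one_ne_zero, imp_false]
    omega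
  · rfl

/-- The contribution of the splitting of `[i, k)` at `j` to the value of a monomial. -/
noncomputable def splitCoeff (i j k : ℕ) (P Q : OpTree JOp X → F) : OpTree JOp X → F
  | .var _ => 0
  | .node .right S T =>
      rightWt F ρ₁ i j k * rightWt F ρ₂ i j k * (P S * Q T) +
        leftWt F ρ₁ i j k * leftWt F ρ₂ i j k * (P T * Q S)
  | .node .left S T =>
      rightWt F ρ₁ i j k * leftWt F ρ₂ i j k * (P S * Q T) +
        leftWt F ρ₁ i j k * rightWt F ρ₂ i j k * (P T * Q S)

variable {ρ₁ ρ₂}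

theorem eval_eq_sum_splitCoeff (a : X → ℕ → ℕ → F) (ha : ∀ x i k, k ≠ i + 1 → a x i k = 0)
    (T : OpTree JOp X) {i k : ℕ} (hk : k ≠ i + 1) :
    T.eval (quadToJ (rankOps F ρ₁ ρ₂)) a i k = ∑ j ∈ Finset.Ioo i k,
      splitCoeff ρ₁ ρ₂ i j k (fun S => S.eval (quadToJ (rankOps F ρ₁ ρ₂)) a i j)
        (fun S => S.eval (quadToJ (rankOps F ρ₁ ρ₂)) a j k) T := by
  rcases T with x | ⟨_ | _, S, T⟩
  · simp [OpTree.eval, splitCoeff, ha x i k hk]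
  · simp [OpTree.eval, splitCoeff, quadToJ, rankOps, weightedMul_apply, Finset.sum_add_distrib]
  · simp [OpTree.eval, splitCoeff, quadToJ, rankOps, weightedMul_apply, Finset.sum_add_distrib]

/-- The indicator function of a monomial. -/
noncomputable def treeInd (F : Type*) [Field F] (A : OpTree JOp X) : OpTree JOp X → F :=
  fun T => if T = A then 1 else 0

/-- For given ranks exactly one of the four weight products is 1, and it selects the symbol and the
order of factors used by `mul`. -/
theorem splitCoeff_treeInd {i j k : ℕ} (A B : RankedTree X)
    (hA : A.2 = (maxRank ρ₁ i j, maxRank ρ₂ i j)) (hB : B.2 = (maxRank ρ₁ j k, maxRank ρ₂ j k)) :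
    splitCoeff ρ₁ ρ₂ i j k (treeInd F A.1) (treeInd F B.1) = treeInd F (mul A B).1 := by
  obtain ⟨A, a⟩ := A
  obtain ⟨B, b⟩ := B
  subst hA hB
  funext T
  rcases T with x | ⟨_ | _, S, T⟩ <;> simp only [splitCoeff, treeInd, mul, rightWt, leftWt] <;>
    split_ifs <;> simp_all

theorem splitCoeff_add_left (i j k : ℕ) (P P' Q : OpTree JOp X → F) :
    splitCoeff ρ₁ ρ₂ i j k (P + P') Q =
      splitCoeff ρ₁ ρ₂ i j k P Q + splitCoeff ρ₁ ρ₂ i j k P' Q := by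
  funext T
  rcases T with x | ⟨_ | _, S, T⟩ <;> simp only [splitCoeff, Pi.add_apply] <;> ring

theorem splitCoeff_add_right (i j k : ℕ) (P Q Q' : OpTree JOp X → F) :
    splitCoeff ρ₁ ρ₂ i j k P (Q + Q') =
      splitCoeff ρ₁ ρ₂ i j k P Q + splitCoeff ρ₁ ρ₂ i j k P Q' := by
  funext T
  rcases T with x | ⟨_ | _, S, T⟩ <;> simp only [splitCoeff, Pi.add_apply] <;> ring

/-- The ranked variable at the position `i` of a word. -/
def rankedVar (ρ₁ ρ₂ : ℕ → ℕ) (w : ℕ → X) (i : ℕ) : RankedTree X := (.var (w i), ρ₁ i, ρ₂ i)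

theorem mul_snd {i j k : ℕ} (hij : i < j) (hjk : j < k) {A B : RankedTree X}
    (hA : A.2 = (maxRank ρ₁ i j, maxRank ρ₂ i j)) (hB : B.2 = (maxRank ρ₁ j k, maxRank ρ₂ j k)) :
    (mul A B).2 = (maxRank ρ₁ i k, maxRank ρ₂ i k) := by
  rw [maxRank_eq_max ρ₁ hij hjk, maxRank_eq_max ρ₂ hij hjk]
  simp [mul, hA, hB]

/-- The value of a monomial at the top right corner counts the bracketings of the word that are
equal to the monomial. -/
theorem eval_wordSubst (w : ℕ → X) (T : OpTree JOp X) :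
    T.eval (quadToJ (rankOps F ρ₁ ρ₂)) (wordSubst F w) 0 4 =
      bracketSum (fun A => treeInd F A T) (rankedVar ρ₁ ρ₂ w 0) (rankedVar ρ₁ ρ₂ w 1)
        (rankedVar ρ₁ ρ₂ w 2) (rankedVar ρ₁ ρ₂ w 3) := by
  set v := rankedVar ρ₁ ρ₂ w with hv
  -- An entry is regarded as a function of the monomial and computed by recursion on the length of
  -- the interval. Intervals of length 1, 2, 3, 4 carry 1, 1, 2, 5 bracketings.
  let V : ℕ → ℕ → OpTree JOp X → F :=
    fun i k T => T.eval (quadToJ (rankOps F ρ₁ ρ₂)) (wordSubst F w) i k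
  have hstep : ∀ i k, k ≠ i + 1 →
      V i k = ∑ j ∈ Finset.Ioo i k, splitCoeff ρ₁ ρ₂ i j k (V i j) (V j k) := by
    intro i k hk
    funext T
    rw [Finset.sum_apply]
    exact eval_eq_sum_splitCoeff _ (fun x i k => wordSubst_of_ne w x) T hk
  have r1 : ∀ i, (v i).2 = (maxRank ρ₁ i (i + 1), maxRank ρ₂ i (i + 1)) := fun i => by
    simp [hv, rankedVar, maxRank_succ]
  have r2 : ∀ i, (mul (v i) (v (i + 1))).2 = (maxRank ρ₁ i (i + 2), maxRank ρ₂ i (i + 2)) :=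
    fun i => mul_snd (by omega) (by omega) (r1 i) (r1 (i + 1))
  have r3 : ∀ i, (mul (v i) (mul (v (i + 1)) (v (i + 2)))).2 =
      (maxRank ρ₁ i (i + 3), maxRank ρ₂ i (i + 3)) :=
    fun i => mul_snd (by omega) (by omega) (r1 i) (r2 (i + 1))
  have r3' : ∀ i, (mul (mul (v i) (v (i + 1))) (v (i + 2))).2 =
      (maxRank ρ₁ i (i + 3), maxRank ρ₂ i (i + 3)) :=
    fun i => mul_snd (by omega) (by omega) (r2 i) (r1 (i + 2))
  have V1 : ∀ i < 4, V i (i + 1) = treeInd F (v i).1 := by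
    intro i hi
    funext T
    rcases T with x | ⟨o, S, T⟩
    · exact wordSubst_succ w x hi
    · have : V i (i + 1) (.node o S T) = 0 := by
        have e : Finset.Ioo i (i + 1) = ∅ := by ext; simp
        rcases o with _ | _ <;> simp [V, e, OpTree.eval, quadToJ, rankOps, weightedMul_apply]
      simp [this, treeInd, hv, rankedVar]
  have V2 : ∀ i < 3, V i (i + 2) = treeInd F (mul (v i) (v (i + 1))).1 := by
    intro i hi
    have e : Finset.Ioo i (i + 2) = {i + 1} := by ext; simp; omega
    rw [hstep _ _ (by omega), e, Finset.sum_singleton, V1 i (by omega), V1 (i + 1) (by omega),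
      splitCoeff_treeInd _ _ (r1 i) (r1 (i + 1))]
  have V3 : ∀ i < 2, V i (i + 3) = treeInd F (mul (v i) (mul (v (i + 1)) (v (i + 2)))).1 +
      treeInd F (mul (mul (v i) (v (i + 1))) (v (i + 2))).1 := by
    intro i hi
    have e : Finset.Ioo i (i + 3) = {i + 1, i + 2} := by ext; simp; omega
    rw [hstep _ _ (by omega), e, Finset.sum_pair (by omega), V1 i (by omega),
      V2 (i + 1) (by omega), V2 i (by omega), V1 (i + 2) (by omega),
      splitCoeff_treeInd _ _ (r1 i) (r2 (i + 1)), splitCoeff_treeInd _ _ (r2 i) (r1 (i + 2))]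
  have V4 : V 0 4 = treeInd F (mul (v 0) (mul (v 1) (mul (v 2) (v 3)))).1 +
      treeInd F (mul (v 0) (mul (mul (v 1) (v 2)) (v 3))).1 +
      treeInd F (mul (mul (v 0) (v 1)) (mul (v 2) (v 3))).1 +
      (treeInd F (mul (mul (v 0) (mul (v 1) (v 2))) (v 3)).1 +
        treeInd F (mul (mul (mul (v 0) (v 1)) (v 2)) (v 3)).1) := by
    have e : Finset.Ioo 0 4 = {1, 2, 3} := rfl
    rw [hstep _ _ (by omega), e, Finset.sum_insert (by simp), Finset.sum_pair (by omega),
      V1 0 (by omega), V3 1 (by omega), V2 0 (by omega), V2 2 (by omega), V3 0 (by omega),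
      V1 3 (by omega), splitCoeff_add_right, splitCoeff_add_left,
      splitCoeff_treeInd _ _ (r1 0) (r3 1), splitCoeff_treeInd _ _ (r1 0) (r3' 1),
      splitCoeff_treeInd _ _ (r2 0) (r2 2), splitCoeff_treeInd _ _ (r3 0) (r1 3),
      splitCoeff_treeInd _ _ (r3' 0) (r1 3)]
    simp only [add_assoc]
  change V 0 4 T = _
  rw [V4]
  simp only [Pi.add_apply, bracketSum]
  ring

theorem bracketSum_eq_zero {f : FreeOpAlg F JOp X} {w : ℕ → X}
    (h : FreeOpAlg.eval (quadToJ (rankOps F ρ₁ ρ₂)) (wordSubst F w) f = 0) :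
    bracketSum f (rankedVar ρ₁ ρ₂ w 0) (rankedVar ρ₁ ρ₂ w 1) (rankedVar ρ₁ ρ₂ w 2)
      (rankedVar ρ₁ ρ₂ w 3) = 0 := by
  have h' := congrFun (congrFun h 0) 4
  rw [FreeOpAlg.eval, Finsupp.linearCombination_apply, Finsupp.sum, Finset.sum_apply,
    Finset.sum_apply] at h'
  have hs : ∀ A, ∑ T ∈ f.support, f T * treeInd F A T = f A := by
    intro A
    simp only [treeInd, mul_ite, mul_one, mul_zero, Finset.sum_ite_eq', Finsupp.mem_support_iff]
    split_ifs with h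
    · rfl
    · exact (not_not.1 h).symm
  simp only [Pi.smul_apply, smul_eq_mul, eval_wordSubst, bracketSum, mul_add,
    Finset.sum_add_distrib, hs] at h'
  exact h'

end Evaluation

/-! ### Linear relations between combs and balanced trees. -/

namespace RankedTree

variable {X : Type*}

/-- The ranks of two ranked monomials are different. -/
def RanksNe (A B : RankedTree X) : Prop := A.2.1 ≠ B.2.1 ∧ A.2.2 ≠ B.2.2

theorem RanksNe.symm {A B : RankedTree X} (h : RanksNe A B) : RanksNe B A := ⟨h.1.symm, h.2.symm⟩

theorem RanksNe.mul {A B C : RankedTree X} (h : RanksNe A C) (h' : RanksNe B C) :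
    RanksNe (mul A B) C := by
  obtain ⟨h₁, h₂⟩ := h
  obtain ⟨h₁', h₂'⟩ := h'
  constructor <;> simp only [RankedTree.mul] <;> omega

theorem RanksNe.comm {A B : RankedTree X} (h : RanksNe A B) : RankedTree.mul A B = .mul B A :=
  mul_comm h.1 h.2

/-- Four ranked monomials have pairwise different ranks. -/
structure RanksPairwiseNe (A B C D : RankedTree X) : Prop where
  ab : RanksNe A B
  ac : RanksNe A C
  ad : RanksNe A D
  bc : RanksNe B C
  bd : RanksNe B D
  cd : RanksNe C D

/-- The product `((A B) C) D`. -/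
def comb (A B C D : RankedTree X) : OpTree JOp X := (mul (mul (mul A B) C) D).1

/-- The product `(A B) (C D)`. -/
def balanced (A B C D : RankedTree X) : OpTree JOp X := (mul (mul A B) (mul C D)).1

variable {A B C D : RankedTree X}

theorem comb_comm (h : RanksNe A B) (C D : RankedTree X) : comb A B C D = comb B A C D := by
  rw [comb, comb, h.comm]

theorem balanced_comm_left (h : RanksNe A B) (C D : RankedTree X) :
    balanced A B C D = balanced B A C D := by
  rw [balanced, balanced, h.comm]

theorem balanced_comm_right (h : RanksNe C D) (A B : RankedTree X) :
    balanced A B C D = balanced A B D C := by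
  rw [balanced, balanced, h.comm]

variable {F : Type*} [Field F]

/-- By commutativity every bracketing other than `(A B) (C D)` can be rewritten as a left comb. -/
theorem bracketSum_eq (c : OpTree JOp X → F) (h : RanksPairwiseNe A B C D) :
    bracketSum c A B C D = c (comb C D B A) + c (comb B C D A) + c (balanced A B C D) +
      c (comb B C A D) + c (comb A B C D) := by
  have e1 : mul A (mul B (mul C D)) = mul (mul (mul C D) B) A := by
    rw [(h.bc.symm.mul h.bd.symm).symm.comm]
    exact (((h.ac.symm.mul h.ad.symm).mul h.ab.symm).symm).comm
  have e2 : mul A (mul (mul B C) D) = mul (mul (mul B C) D) A :=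
    ((h.ab.symm.mul h.ac.symm).mul h.ad.symm).symm.comm
  have e3 : mul A (mul B C) = mul (mul B C) A := (h.ab.symm.mul h.ac.symm).symm.comm
  simp only [bracketSum, comb, balanced, e1, e2, e3]

section

variable {c : OpTree JOp X → F} {v : Fin 4 → RankedTree X}
  (hv : ∀ i j, i ≠ j → RanksNe (v i) (v j))
  (hc : ∀ i j k l, [i, j, k, l].Nodup → bracketSum c (v i) (v j) (v k) (v l) = 0)
include hv hc

theorem bracketSum_relation {i j k l : Fin 4} (h : [i, j, k, l].Nodup) :
    c (comb (v k) (v l) (v j) (v i)) + c (comb (v j) (v k) (v l) (v i)) +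
      c (balanced (v i) (v j) (v k) (v l)) + c (comb (v j) (v k) (v i) (v l)) +
      c (comb (v i) (v j) (v k) (v l)) = 0 := by
  rw [← hc i j k l h, bracketSum_eq]
  simp only [List.nodup_cons, List.mem_cons, not_or, List.not_mem_nil] at h
  constructor <;> apply hv <;> tauto

/-- Together with `comb_comm` this makes the coefficient at a comb symmetric in the three letters
outside the third place. -/
theorem comb_swap_outer (h2 : (2 : F) ≠ 0) {i j k l : Fin 4} (h : [i, j, k, l].Nodup) :
    c (comb (v i) (v j) (v k) (v l)) = c (comb (v i) (v l) (v k) (v j)) := by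
  have e1 := bracketSum_relation hv hc (i := j) (j := i) (k := l) (l := k) (by grind)
  have e2 := bracketSum_relation hv hc (i := j) (j := i) (k := k) (l := l) (by grind)
  have e3 := bracketSum_relation hv hc (i := j) (j := k) (k := i) (l := l) (by grind)
  have e4 := bracketSum_relation hv hc (i := k) (j := j) (k := i) (l := l) (by grind)
  have hij := hv j i (by grind)
  have hik := hv k i (by grind)
  have hjk := hv k j (by grind)
  have hkl := hv l k (by grind)
  simp only [comb_comm hij, comb_comm hik, comb_comm hjk, comb_comm hkl, balanced_comm_left hij,
    balanced_comm_left hjk, balanced_comm_right hkl] at e1 e2 e3 e4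
  -- The words of `e1`, `e2` have the same balanced tree, and so do those of `e3`, `e4`. In `(e2 -
  -- e1) + (e4 - e3)` everything cancels except twice the asserted difference.
  apply mul_left_cancel₀ h2
  linear_combination -e1 + e2 - e3 + e4

/-- The four combs on the right have the third letters `i`, `j`, `k`, `l`: one comb for each class
left by `comb_swap_outer`. -/
theorem balanced_eq (h2 : (2 : F) ≠ 0) {i j k l : Fin 4} (h : [i, j, k, l].Nodup) :
    c (balanced (v i) (v j) (v k) (v l)) = -(c (comb (v j) (v k) (v i) (v l)) +
      c (comb (v i) (v k) (v j) (v l)) + c (comb (v i) (v j) (v k) (v l)) +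
      c (comb (v j) (v k) (v l) (v i))) := by
  have e1 := bracketSum_relation hv hc (i := j) (j := i) (k := k) (l := l) (by grind)
  have e2 := bracketSum_relation hv hc (i := i) (j := k) (k := l) (l := j) (by grind)
  have e3 := bracketSum_relation hv hc (i := i) (j := k) (k := j) (l := l) (by grind)
  have e4 := bracketSum_relation hv hc h
  have hij := hv j i (by grind)
  have hjk := hv k j (by grind)
  have hjl := hv l j (by grind)
  simp only [comb_comm hij, comb_comm hjk, comb_comm hjl, balanced_comm_left hij,
    balanced_comm_right hjl] at e1 e2 e3 e4 ⊢
  apply mul_left_cancel₀ h2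
  linear_combination e1 - e2 + e3 + e4

end

end RankedTree

/-! ### Orientations of bracketings -/

/-- The product of two monomials whose operation symbol and order of factors are determined by
two comparisons. -/
def orient {X : Type*} : Bool → Bool → OpTree JOp X → OpTree JOp X → OpTree JOp X
  | true, true, S, T => .node .right S T
  | true, false, S, T => .node .left S T
  | false, true, S, T => .node .left T S
  | false, false, S, T => .node .right T S

theorem RankedTree.mul_fst {X : Type*} (A B : RankedTree X) :
    (mul A B).1 = orient (A.2.1 < B.2.1) (A.2.2 < B.2.2) A.1 B.1 := by
  by_cases h₁ : A.2.1 < B.2.1 <;> by_cases h₂ : A.2.2 < B.2.2 <;> simp [mul, orient, h₁, h₂]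

theorem exists_orient {X : Type*} (o : JOp) (S T : OpTree JOp X) :
    ∃ p q, .node o S T = orient p q S T := by
  cases o
  exacts [⟨true, false, rfl⟩, ⟨true, true, rfl⟩]

theorem exists_orient_swap {X : Type*} (o : JOp) (S T : OpTree JOp X) :
    ∃ p q, .node o S T = orient p q T S := by
  cases o
  exacts [⟨false, true, rfl⟩, ⟨false, false, rfl⟩]

/-- The comparisons of ranks that determine a bracketing `((a b) t) x`. -/
def combPattern (w : Fin 4 → Fin 4) (a b t x : Fin 4) : Bool × Bool × Bool :=
  (w a < w b, max (w a) (w b) < w t, max (max (w a) (w b)) (w t) < w x)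

/-- The comparisons of ranks that determine a bracketing `(a b) (t x)`. -/
def balancedPattern (w : Fin 4 → Fin 4) (a b t x : Fin 4) : Bool × Bool × Bool :=
  (w a < w b, w t < w x, max (w a) (w b) < max (w t) (w x))

/-- A letter with two ranks. -/
def rankedLetter (w₁ w₂ : Fin 4 → Fin 4) (i : Fin 4) : RankedTree (Fin 4) := (.var i, w₁ i, w₂ i)

theorem comb_rankedLetter (w₁ w₂ : Fin 4 → Fin 4) (a b t x : Fin 4) :
    RankedTree.comb (rankedLetter w₁ w₂ a) (rankedLetter w₁ w₂ b) (rankedLetter w₁ w₂ t)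
      (rankedLetter w₁ w₂ x) =
    orient (combPattern w₁ a b t x).2.2 (combPattern w₂ a b t x).2.2
      (orient (combPattern w₁ a b t x).2.1 (combPattern w₂ a b t x).2.1
        (orient (combPattern w₁ a b t x).1 (combPattern w₂ a b t x).1 (.var a) (.var b))
        (.var t)) (.var x) := by
  simp only [RankedTree.comb, RankedTree.mul_fst, combPattern, Fin.lt_def, Fin.coe_max]
  rfl

theorem balanced_rankedLetter (w₁ w₂ : Fin 4 → Fin 4) (a b t x : Fin 4) :
    RankedTree.balanced (rankedLetter w₁ w₂ a) (rankedLetter w₁ w₂ b) (rankedLetter w₁ w₂ t)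
      (rankedLetter w₁ w₂ x) =
    orient (balancedPattern w₁ a b t x).2.2 (balancedPattern w₂ a b t x).2.2
      (orient (balancedPattern w₁ a b t x).1 (balancedPattern w₂ a b t x).1 (.var a) (.var b))
      (orient (balancedPattern w₁ a b t x).2.1 (balancedPattern w₂ a b t x).2.1
        (.var t) (.var x)) := by
  simp only [RankedTree.balanced, RankedTree.mul_fst, balancedPattern, Fin.lt_def, Fin.coe_max]
  rfl

/-- A ranking of the letters in which `l` has the highest rank. -/
def topRank (l : Fin 4) : Fin 4 → Fin 4 := Equiv.swap l 3

/-- Two rankings with the same pattern on one comb with third letter `t` orient that comb in the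
same way. In at most two such steps any ranking reaches `topRank l`, possibly through its variant
with the two lowest ranks exchanged. Each pattern determines the letter of highest rank, so `l` is
necessarily that letter. -/
theorem exists_pattern_chain : ∀ t a b c d : Fin 4, Function.Injective ![a, b, c, d] →
    ∃ l, ∃ w' ∈ [(topRank l : Fin 4 → Fin 4), Equiv.swap 0 1 ∘ topRank l],
      (∃ i j k, [i, j, t, k].Nodup ∧
        combPattern ![a, b, c, d] i j t k = combPattern w' i j t k) ∧
      ∃ i j k, [i, j, t, k].Nodup ∧ combPattern w' i j t k = combPattern (topRank l) i j t k := by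
  decide

theorem exists_combPattern : ∀ p : Bool × Bool × Bool, ∃ a b c d : Fin 4,
    Function.Injective ![a, b, c, d] ∧ combPattern ![a, b, c, d] 0 1 2 3 = p := by
  decide

theorem exists_balancedPattern : ∀ p : Bool × Bool × Bool, ∃ a b c d : Fin 4,
    Function.Injective ![a, b, c, d] ∧ balancedPattern ![a, b, c, d] 0 1 2 3 = p := by
  decide

theorem ranksNe_rankedLetter {w₁ w₂ : Fin 4 → Fin 4} (h₁ : Function.Injective w₁)
    (h₂ : Function.Injective w₂) (i j : Fin 4) (hij : i ≠ j) :
    RankedTree.RanksNe (rankedLetter w₁ w₂ i) (rankedLetter w₁ w₂ j) :=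
  ⟨fun h => hij (h₁ (Fin.ext h)), fun h => hij (h₂ (Fin.ext h))⟩

/-- The bracketing `((a b) t) x` of four letters, oriented by two rankings. -/
def letterComb (w₁ w₂ : Fin 4 → Fin 4) (a b t x : Fin 4) : OpTree JOp (Fin 4) :=
  RankedTree.comb (rankedLetter w₁ w₂ a) (rankedLetter w₁ w₂ b) (rankedLetter w₁ w₂ t)
    (rankedLetter w₁ w₂ x)

/-- The bracketing `(a b) (t x)` of four letters, oriented by two rankings. -/
def letterBalanced (w₁ w₂ : Fin 4 → Fin 4) (a b t x : Fin 4) : OpTree JOp (Fin 4) :=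
  RankedTree.balanced (rankedLetter w₁ w₂ a) (rankedLetter w₁ w₂ b) (rankedLetter w₁ w₂ t)
    (rankedLetter w₁ w₂ x)

/-- The sums over the five bracketings of any word in four letters vanish for all rankings. -/
def BracketSumsVanish {F : Type*} [Field F] (c : OpTree JOp (Fin 4) → F) : Prop :=
  ∀ w₁ w₂ : Fin 4 → Fin 4, Function.Injective w₁ → Function.Injective w₂ →
    ∀ i j k l : Fin 4, [i, j, k, l].Nodup →
      RankedTree.bracketSum c (rankedLetter w₁ w₂ i) (rankedLetter w₁ w₂ j)
        (rankedLetter w₁ w₂ k) (rankedLetter w₁ w₂ l) = 0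

/-- One oriented comb for each third letter `t` and each pair of letters of highest rank. -/
def refComb (t l l' : Fin 4) : OpTree JOp (Fin 4) :=
  letterComb (topRank l) (topRank l') (t + 1) (t + 2) t (t + 3)

section

variable {F : Type*} [Field F] {c : OpTree JOp (Fin 4) → F} (h2 : (2 : F) ≠ 0)
  (hc : BracketSumsVanish c)
include h2 hc

/-- The transpositions from `comb_comm` and `comb_swap_outer` generate all permutations of the
letters other than `t`. -/
theorem letterComb_congr {w₁ w₂ : Fin 4 → Fin 4} (h₁ : Function.Injective w₁)
    (h₂ : Function.Injective w₂) {a b t x a' b' x' : Fin 4} (h : [a, b, t, x].Nodup)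
    (h' : [a', b', t, x'].Nodup) :
    c (letterComb w₁ w₂ a b t x) = c (letterComb w₁ w₂ a' b' t x') := by
  have hv := ranksNe_rankedLetter h₁ h₂
  have hs : ∀ {a b t x : Fin 4}, [a, b, t, x].Nodup →
      c (letterComb w₁ w₂ a b t x) = c (letterComb w₁ w₂ a x t b) := fun h =>
    RankedTree.comb_swap_outer hv (hc w₁ w₂ h₁ h₂) h2 h
  have hm : ∀ {a b t x : Fin 4}, [a, b, t, x].Nodup →
      c (letterComb w₁ w₂ a b t x) = c (letterComb w₁ w₂ b a t x) := fun {a b t x} h =>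
    congrArg c (RankedTree.comb_comm (hv a b (by grind)) _ _)
  have hcov : ∀ a b t x y : Fin 4, [a, b, t, x].Nodup → t ≠ y → y = a ∨ y = b ∨ y = x := by decide
  rcases hcov a b t x x' h (by grind) with rfl | rfl | rfl <;>
  rcases hcov _ _ t _ a' h (by grind) with rfl | rfl | rfl <;>
  rcases hcov _ _ t _ b' h (by grind) with rfl | rfl | rfl <;>
  first
  | (exfalso; revert h'; simp; done)
  | rfl
  | exact hm h
  | exact hs h
  | exact (hs h).trans (hm (by grind))
  | exact (hm h).trans (hs (by grind))
  | exact (hm h).trans ((hs (by grind)).trans (hm (by grind)))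

/-- The letters are rearranged, with `t` fixed, to an arrangement on which `w₁` and `w₁'` have the
same pattern. There the two oriented combs are the same monomial. -/
theorem letterComb_congr_rank_left {w₁ w₁' w₂ : Fin 4 → Fin 4} (h₁ : Function.Injective w₁)
    (h₁' : Function.Injective w₁') (h₂ : Function.Injective w₂) {a b t x i j k : Fin 4}
    (h : [a, b, t, x].Nodup) (h' : [i, j, t, k].Nodup)
    (hp : combPattern w₁ i j t k = combPattern w₁' i j t k) :
    c (letterComb w₁ w₂ a b t x) = c (letterComb w₁' w₂ a b t x) := by
  rw [letterComb_congr h2 hc h₁ h₂ h h', letterComb_congr h2 hc h₁' h₂ h h']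
  simp only [letterComb, comb_rankedLetter, hp]

theorem letterComb_congr_rank_right {w₁ w₂ w₂' : Fin 4 → Fin 4} (h₁ : Function.Injective w₁)
    (h₂ : Function.Injective w₂) (h₂' : Function.Injective w₂') {a b t x i j k : Fin 4}
    (h : [a, b, t, x].Nodup) (h' : [i, j, t, k].Nodup)
    (hp : combPattern w₂ i j t k = combPattern w₂' i j t k) :
    c (letterComb w₁ w₂ a b t x) = c (letterComb w₁ w₂' a b t x) := by
  rw [letterComb_congr h2 hc h₁ h₂ h h', letterComb_congr h2 hc h₁ h₂' h h']
  simp only [letterComb, comb_rankedLetter, hp]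

/-- The chain of rankings is followed first for `w₁` and then for `w₂`, so that only 64 coefficients
at combs remain. -/
theorem exists_refComb_eq {w₁ w₂ : Fin 4 → Fin 4} (h₁ : Function.Injective w₁)
    (h₂ : Function.Injective w₂) {a b t x : Fin 4} (h : [a, b, t, x].Nodup) :
    ∃ l l', c (letterComb w₁ w₂ a b t x) = c (refComb t l l') := by
  have hw : ∀ w : Fin 4 → Fin 4, ![w 0, w 1, w 2, w 3] = w := fun w => by
    ext i; fin_cases i <;> rfl
  have hinj : ∀ l, ∀ w' ∈ [(topRank l : Fin 4 → Fin 4), Equiv.swap 0 1 ∘ topRank l],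
      Function.Injective w' := by
    intro l w' hw'
    simp only [List.mem_cons, List.not_mem_nil, or_false] at hw'
    rcases hw' with rfl | rfl
    exacts [(Equiv.swap l 3).injective, (Equiv.swap 0 1).injective.comp (Equiv.swap l 3).injective]
  obtain ⟨l, w₁', m₁, ⟨i, j, k, n, p⟩, i', j', k', n', p'⟩ := exists_pattern_chain t (w₁ 0) (w₁ 1)
    (w₁ 2) (w₁ 3) (by rwa [hw])
  obtain ⟨l', w₂', m₂, ⟨r, s, u, o, q⟩, r', s', u', o', q'⟩ := exists_pattern_chain t (w₂ 0) (w₂ 1)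
    (w₂ 2) (w₂ 3) (by rwa [hw])
  rw [hw] at p q
  have tl : Function.Injective (topRank l) := (Equiv.swap l 3).injective
  have tl' : Function.Injective (topRank l') := (Equiv.swap l' 3).injective
  refine ⟨l, l', ?_⟩
  rw [letterComb_congr_rank_left h2 hc h₁ (hinj _ _ m₁) h₂ h n p,
    letterComb_congr_rank_left h2 hc (hinj _ _ m₁) tl h₂ h n' p',
    letterComb_congr_rank_right h2 hc tl h₂ (hinj _ _ m₂) h o q,
    letterComb_congr_rank_right h2 hc tl (hinj _ _ m₂) tl' h o' q']
  exact letterComb_congr h2 hc tl tl' h (by clear * -; decide +revert)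

end

/-! ### Every multilinear monomial of degree four as an oriented comb or balanced tree. -/

section Shapes

/-- A pattern that occurs for some ranking of the letters `0, 1, 2, 3` occurs for every word of four
different letters. -/
theorem exists_rank_of_pattern
    {P : (Fin 4 → Fin 4) → Fin 4 → Fin 4 → Fin 4 → Fin 4 → Bool × Bool × Bool}
    (hP : ∀ p, ∃ a b c d : Fin 4, Function.Injective ![a, b, c, d] ∧ P ![a, b, c, d] 0 1 2 3 = p)
    (hcomp : ∀ (w : Fin 4 → Fin 4) (σ : Equiv.Perm (Fin 4)) i j k l,
      P (w ∘ σ.symm) (σ i) (σ j) (σ k) (σ l) = P w i j k l)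
    {a b t x : Fin 4} (h : [a, b, t, x].Nodup) (p : Bool × Bool × Bool) :
    ∃ w : Fin 4 → Fin 4, Function.Injective w ∧ P w a b t x = p := by
  have hφ : Function.Injective ![a, b, t, x] := by
    simpa [List.ofFn_succ] using (List.nodup_ofFn (f := ![a, b, t, x])).1 (by simpa using h)
  let σ : Equiv.Perm (Fin 4) := Equiv.ofBijective _ (Finite.injective_iff_bijective.1 hφ)
  obtain ⟨i, j, k, l, hw, e⟩ := hP p
  exact ⟨![i, j, k, l] ∘ σ.symm, hw.comp σ.symm.injective, (hcomp _ σ 0 1 2 3).trans e⟩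

theorem exists_letterComb_eq {a b t x : Fin 4} (h : [a, b, t, x].Nodup)
    (p₁ p₂ p₃ q₁ q₂ q₃ : Bool) : ∃ w₁ w₂, Function.Injective w₁ ∧ Function.Injective w₂ ∧
      orient p₃ q₃ (orient p₂ q₂ (orient p₁ q₁ (.var a) (.var b)) (.var t)) (.var x) =
        letterComb w₁ w₂ a b t x := by
  obtain ⟨w₁, h₁, e₁⟩ := exists_rank_of_pattern (P := combPattern) exists_combPattern
    (fun w σ i j k l => by simp [combPattern]) h (p₁, p₂, p₃)
  obtain ⟨w₂, h₂, e₂⟩ := exists_rank_of_pattern (P := combPattern) exists_combPattern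
    (fun w σ i j k l => by simp [combPattern]) h (q₁, q₂, q₃)
  exact ⟨w₁, w₂, h₁, h₂, by simp only [letterComb, comb_rankedLetter, e₁, e₂]⟩

theorem exists_letterBalanced_eq {a b t x : Fin 4} (h : [a, b, t, x].Nodup)
    (p₁ p₂ p₃ q₁ q₂ q₃ : Bool) : ∃ w₁ w₂, Function.Injective w₁ ∧ Function.Injective w₂ ∧
      orient p₃ q₃ (orient p₁ q₁ (.var a) (.var b)) (orient p₂ q₂ (.var t) (.var x)) =
        letterBalanced w₁ w₂ a b t x := by
  obtain ⟨w₁, h₁, e₁⟩ := exists_rank_of_pattern (P := balancedPattern) exists_balancedPattern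
    (fun w σ i j k l => by simp [balancedPattern]) h (p₁, p₂, p₃)
  obtain ⟨w₂, h₂, e₂⟩ := exists_rank_of_pattern (P := balancedPattern) exists_balancedPattern
    (fun w σ i j k l => by simp [balancedPattern]) h (q₁, q₂, q₃)
  exact ⟨w₁, w₂, h₁, h₂, by simp only [letterBalanced, balanced_rankedLetter, e₁, e₂]⟩

theorem OpTree.card_leaves_pos {Ω X : Type*} (T : OpTree Ω X) : 0 < Multiset.card T.leaves := by
  induction T with
  | var x => simp [OpTree.leaves]
  | node o S T hS hT => simp only [OpTree.leaves, Multiset.card_add]; omega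

theorem OpTree.card_leaves_eq_one {Ω X : Type*} {T : OpTree Ω X} (h : Multiset.card T.leaves = 1) :
    ∃ x, T = .var x := by
  rcases T with x | ⟨o, S, T⟩
  · exact ⟨x, rfl⟩
  · have := S.card_leaves_pos
    have := T.card_leaves_pos
    simp only [OpTree.leaves, Multiset.card_add] at h
    omega

theorem OpTree.card_leaves_eq_two {Ω X : Type*} {T : OpTree Ω X} (h : Multiset.card T.leaves = 2) :
    ∃ o x y, T = .node o (.var x) (.var y) := by
  rcases T with x | ⟨o, S, T⟩
  · simp [OpTree.leaves] at h
  · have hS := S.card_leaves_pos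
    have hT := T.card_leaves_pos
    simp only [OpTree.leaves, Multiset.card_add] at h
    obtain ⟨x, rfl⟩ := OpTree.card_leaves_eq_one (T := S) (by omega)
    obtain ⟨y, rfl⟩ := OpTree.card_leaves_eq_one (T := T) (by omega)
    exact ⟨o, x, y, rfl⟩

theorem OpTree.card_leaves_eq_three {Ω X : Type*} {T : OpTree Ω X}
    (h : Multiset.card T.leaves = 3) :
    ∃ o o' x y z, T = .node o (.var x) (.node o' (.var y) (.var z)) ∨
      T = .node o (.node o' (.var x) (.var y)) (.var z) := by
  rcases T with x | ⟨o, S, T⟩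
  · simp [OpTree.leaves] at h
  · have hS := S.card_leaves_pos
    have hT := T.card_leaves_pos
    simp only [OpTree.leaves, Multiset.card_add] at h
    obtain hS | hS : Multiset.card S.leaves = 1 ∨ Multiset.card S.leaves = 2 := by omega
    · obtain ⟨x, rfl⟩ := OpTree.card_leaves_eq_one hS
      obtain ⟨o', y, z, rfl⟩ := OpTree.card_leaves_eq_two (T := T) (by omega)
      exact ⟨o, o', x, y, z, .inl rfl⟩
    · obtain ⟨o', x, y, rfl⟩ := OpTree.card_leaves_eq_two hS
      obtain ⟨z, rfl⟩ := OpTree.card_leaves_eq_one (T := T) (by omega)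
      exact ⟨o, o', x, y, z, .inr rfl⟩

/-- The five nonassociative words of length four, with three operation symbols. -/
def quartic {Ω X : Type*} (s : Fin 5) (o : Ω × Ω × Ω) (x : Fin 4 → X) : OpTree Ω X :=
  ![.node o.1 (.var (x 0)) (.node o.2.1 (.var (x 1)) (.node o.2.2 (.var (x 2)) (.var (x 3)))),
    .node o.1 (.var (x 0)) (.node o.2.1 (.node o.2.2 (.var (x 1)) (.var (x 2))) (.var (x 3))),
    .node o.1 (.node o.2.1 (.var (x 0)) (.var (x 1))) (.node o.2.2 (.var (x 2)) (.var (x 3))),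
    .node o.1 (.node o.2.1 (.var (x 0)) (.node o.2.2 (.var (x 1)) (.var (x 2)))) (.var (x 3)),
    .node o.1 (.node o.2.1 (.node o.2.2 (.var (x 0)) (.var (x 1))) (.var (x 2))) (.var (x 3))] s

theorem OpTree.exists_quartic_eq {Ω X : Type*} {T : OpTree Ω X}
    (h : Multiset.card T.leaves = 4) : ∃ s o x, T = quartic s o x := by
  rcases T with x | ⟨o, S, T⟩
  · simp [OpTree.leaves] at h
  · have hS := S.card_leaves_pos
    have hT := T.card_leaves_pos
    simp only [OpTree.leaves, Multiset.card_add] at h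
    obtain hS | hS | hS : Multiset.card S.leaves = 1 ∨ Multiset.card S.leaves = 2 ∨
      Multiset.card S.leaves = 3 := by omega
    · obtain ⟨x, rfl⟩ := OpTree.card_leaves_eq_one hS
      obtain ⟨o', o'', y, z, u, rfl | rfl⟩ := OpTree.card_leaves_eq_three (T := T) (by omega)
      · exact ⟨0, (o, o', o''), ![x, y, z, u], rfl⟩
      · exact ⟨1, (o, o', o''), ![x, y, z, u], rfl⟩
    · obtain ⟨o', x, y, rfl⟩ := OpTree.card_leaves_eq_two hS
      obtain ⟨o'', z, u, rfl⟩ := OpTree.card_leaves_eq_two (T := T) (by omega)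
      exact ⟨2, (o, o', o''), ![x, y, z, u], rfl⟩
    · obtain ⟨u, rfl⟩ := OpTree.card_leaves_eq_one (T := T) (by omega)
      obtain ⟨o', o'', x, y, z, rfl | rfl⟩ := OpTree.card_leaves_eq_three hS
      · exact ⟨3, (o, o', o''), ![x, y, z, u], rfl⟩
      · exact ⟨4, (o, o', o''), ![x, y, z, u], rfl⟩

theorem leaves_quartic {Ω X : Type*} (s : Fin 5) (o : Ω × Ω × Ω) (x : Fin 4 → X) :
    (quartic s o x).leaves = Multiset.map x Finset.univ.val := by
  have e : Multiset.map x Finset.univ.val = {x 0} + {x 1} + {x 2} + {x 3} := by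
    rw [Fin.univ_val_map]
    rfl
  rw [e]
  fin_cases s <;> simp only [quartic, add_assoc] <;> rfl

/-- Each node can be read as an oriented product of its factors in either order, which turns the
five shapes into two. The three pairs of comparisons so obtained are realized by two rankings chosen
independently, since each ranking can have any pattern. -/
theorem exists_letterComb_or_letterBalanced {T : OpTree JOp (Fin 4)}
    (hT : T.leaves = (Finset.univ : Finset (Fin 4)).val) :
    ∃ w₁ w₂ a b t x, Function.Injective w₁ ∧ Function.Injective w₂ ∧ [a, b, t, x].Nodup ∧
      (T = letterComb w₁ w₂ a b t x ∨ T = letterBalanced w₁ w₂ a b t x) := by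
  obtain ⟨s, ⟨o, o', o''⟩, x, rfl⟩ := OpTree.exists_quartic_eq (T := T) (by simp [hT])
  have hx : Function.Injective x := by
    rw [leaves_quartic] at hT
    have : (Multiset.map x Finset.univ.val).Nodup := by rw [hT]; exact Finset.univ.nodup
    exact fun i j h => Multiset.inj_on_of_nodup_map this i (by simp) j (by simp) h
  have n : [x 0, x 1, x 2, x 3].Nodup := by
    simp [hx.eq_iff]
  fin_cases s
  · obtain ⟨p₁, q₁, e₁⟩ := exists_orient o'' (OpTree.var (x 2)) (.var (x 3))
    obtain ⟨p₂, q₂, e₂⟩ := exists_orient_swap o' (.var (x 1))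
      (orient p₁ q₁ (.var (x 2)) (.var (x 3)))
    obtain ⟨p₃, q₃, e₃⟩ := exists_orient_swap o (.var (x 0)) (orient p₂ q₂
      (orient p₁ q₁ (.var (x 2)) (.var (x 3))) (.var (x 1)))
    have n' : [x 2, x 3, x 1, x 0].Nodup := by grind
    obtain ⟨w₁, w₂, h₁, h₂, e⟩ := exists_letterComb_eq n' p₁ p₂ p₃ q₁ q₂ q₃
    exact ⟨w₁, w₂, _, _, _, _, h₁, h₂, n', .inl (by simp [quartic, e₁, e₂, e₃, e])⟩
  · obtain ⟨p₁, q₁, e₁⟩ := exists_orient o'' (OpTree.var (x 1)) (.var (x 2))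
    obtain ⟨p₂, q₂, e₂⟩ := exists_orient o' (orient p₁ q₁ (.var (x 1)) (.var (x 2))) (.var (x 3))
    obtain ⟨p₃, q₃, e₃⟩ := exists_orient_swap o (.var (x 0)) (orient p₂ q₂
      (orient p₁ q₁ (.var (x 1)) (.var (x 2))) (.var (x 3)))
    have n' : [x 1, x 2, x 3, x 0].Nodup := by grind
    obtain ⟨w₁, w₂, h₁, h₂, e⟩ := exists_letterComb_eq n' p₁ p₂ p₃ q₁ q₂ q₃
    exact ⟨w₁, w₂, _, _, _, _, h₁, h₂, n', .inl (by simp [quartic, e₁, e₂, e₃, e])⟩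
  · obtain ⟨p₁, q₁, e₁⟩ := exists_orient o' (OpTree.var (x 0)) (.var (x 1))
    obtain ⟨p₂, q₂, e₂⟩ := exists_orient o'' (OpTree.var (x 2)) (.var (x 3))
    obtain ⟨p₃, q₃, e₃⟩ := exists_orient o (orient p₁ q₁ (.var (x 0)) (.var (x 1)))
      (orient p₂ q₂ (.var (x 2)) (.var (x 3)))
    obtain ⟨w₁, w₂, h₁, h₂, e⟩ := exists_letterBalanced_eq n p₁ p₂ p₃ q₁ q₂ q₃
    exact ⟨w₁, w₂, _, _, _, _, h₁, h₂, n, .inr (by simp [quartic, e₁, e₂, e₃, e])⟩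
  · obtain ⟨p₁, q₁, e₁⟩ := exists_orient o'' (OpTree.var (x 1)) (.var (x 2))
    obtain ⟨p₂, q₂, e₂⟩ := exists_orient_swap o' (.var (x 0))
      (orient p₁ q₁ (.var (x 1)) (.var (x 2)))
    obtain ⟨p₃, q₃, e₃⟩ := exists_orient o (orient p₂ q₂
      (orient p₁ q₁ (.var (x 1)) (.var (x 2))) (.var (x 0))) (.var (x 3))
    have n' : [x 1, x 2, x 0, x 3].Nodup := by grind
    obtain ⟨w₁, w₂, h₁, h₂, e⟩ := exists_letterComb_eq n' p₁ p₂ p₃ q₁ q₂ q₃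
    exact ⟨w₁, w₂, _, _, _, _, h₁, h₂, n', .inl (by simp [quartic, e₁, e₂, e₃, e])⟩
  · obtain ⟨p₁, q₁, e₁⟩ := exists_orient o'' (OpTree.var (x 0)) (.var (x 1))
    obtain ⟨p₂, q₂, e₂⟩ := exists_orient o' (orient p₁ q₁ (.var (x 0)) (.var (x 1))) (.var (x 2))
    obtain ⟨p₃, q₃, e₃⟩ := exists_orient o (orient p₂ q₂
      (orient p₁ q₁ (.var (x 0)) (.var (x 1))) (.var (x 2))) (.var (x 3))
    obtain ⟨w₁, w₂, h₁, h₂, e⟩ := exists_letterComb_eq n p₁ p₂ p₃ q₁ q₂ q₃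
    exact ⟨w₁, w₂, _, _, _, _, h₁, h₂, n, .inl (by simp [quartic, e₁, e₂, e₃, e])⟩

end Shapes

/-- This is the upper bound 64 for the dimension of the space of multilinear solutions: combs reduce
to reference combs, and balanced trees to combs. -/
theorem eq_zero_of_refComb_eq_zero {F : Type*} [Field F] {c : OpTree JOp (Fin 4) → F}
    (h2 : (2 : F) ≠ 0) (hc : BracketSumsVanish c) (h0 : ∀ t l l', c (refComb t l l') = 0)
    {T : OpTree JOp (Fin 4)} (hT : T.leaves = (Finset.univ : Finset (Fin 4)).val) : c T = 0 := by
  obtain ⟨w₁, w₂, a, b, t, x, h₁, h₂, n, rfl | rfl⟩ := exists_letterComb_or_letterBalanced hT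
  · obtain ⟨l, l', e⟩ := exists_refComb_eq h2 hc h₁ h₂ n
    rw [e, h0]
  · have hz : ∀ {a b t x : Fin 4}, [a, b, t, x].Nodup → c (letterComb w₁ w₂ a b t x) = 0 := by
      intro a b t x n
      obtain ⟨l, l', e⟩ := exists_refComb_eq h2 hc h₁ h₂ n
      rw [e, h0]
    have e := RankedTree.balanced_eq (ranksNe_rankedLetter h₁ h₂) (hc w₁ w₂ h₁ h₂) h2 n
    simp only [letterComb] at hz
    rw [letterBalanced, e, hz (by grind), hz (by grind), hz (by grind), hz (by grind)]
    simp

/-! ### Homomorphisms -/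

section Hom

variable {F Ω X A B : Type*} [Field F] [AddCommGroup A] [Module F A] [AddCommGroup B] [Module F B]

/-- `ψ` is a homomorphism of algebras with a family of bilinear operations. -/
def IsOpHom (m : BilinOps F Ω A) (m' : BilinOps F Ω B) (ψ : A →ₗ[F] B) : Prop :=
  ∀ o a b, ψ (m o a b) = m' o (ψ a) (ψ b)

theorem FreeOpAlg.ops_single (o : Ω) (S T : OpTree Ω X) (a b : F) :
    FreeOpAlg.ops F Ω X o (Finsupp.single S a) (Finsupp.single T b) =
      Finsupp.single (.node o S T) (a * b) := by
  simp [FreeOpAlg.ops]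

theorem FreeOpAlg.isOpHom_eval (m : BilinOps F Ω A) (a : X → A) :
    IsOpHom (FreeOpAlg.ops F Ω X) m (FreeOpAlg.eval m a) := by
  intro o p q
  induction p using Finsupp.induction_linear with
  | zero => simp
  | add p p' hp hp' => simp [hp, hp']
  | single S c =>
    induction q using Finsupp.induction_linear with
    | zero => simp
    | add q q' hq hq' => simp [hq, hq']
    | single T d =>
      simp only [FreeOpAlg.ops_single, FreeOpAlg.eval, OpTree.eval, smul_smul, map_smul,
        Finsupp.linearCombination_single, LinearMap.smul_apply, mul_comm d c]

theorem FreeOpAlg.eval_var (m : BilinOps F Ω A) (a : X → A) (x : X) :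
    FreeOpAlg.eval m a (FreeOpAlg.var F Ω x) = a x := by
  simp [FreeOpAlg.eval, FreeOpAlg.var, OpTree.eval]

theorem IsOpHom.map_treeEval {m : BilinOps F Ω A} {m' : BilinOps F Ω B} {ψ : A →ₗ[F] B}
    (h : IsOpHom m m' ψ) (a : X → A) (T : OpTree Ω X) :
    ψ (T.eval m a) = T.eval m' (fun x => ψ (a x)) := by
  induction T with
  | var x => rfl
  | node o S T hS hT => simp [OpTree.eval, h o, hS, hT]

theorem IsOpHom.map_eval {m : BilinOps F Ω A} {m' : BilinOps F Ω B} {ψ : A →ₗ[F] B}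
    (h : IsOpHom m m' ψ) (a : X → A) (f : FreeOpAlg F Ω X) :
    ψ (FreeOpAlg.eval m a f) = FreeOpAlg.eval m' (fun x => ψ (a x)) f := by
  simp [FreeOpAlg.eval, Finsupp.linearCombination_apply, Finsupp.sum, h.map_treeEval]

theorem IsOpHom.map_quadIdentity {m : BilinOps F QuadOp A} {m' : BilinOps F QuadOp B}
    {ψ : A →ₗ[F] B} (h : IsOpHom m m' ψ) (x y z : A) (i : Fin 9) :
    ψ (Quad.identity m x y z i) = Quad.identity m' (ψ x) (ψ y) (ψ z) i := by
  have h' : ∀ o a b, ψ (m o a b) = m' o (ψ a) (ψ b) := h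
  fin_cases i <;>
    simp [Quad.identity, Quad.assocR, Quad.assocL, Quad.assocNE, Quad.assocSW, Quad.assocN,
      Quad.assocW, Quad.assocS, Quad.assocE, Quad.assocM, Quad.star, Quad.succ, Quad.prec,
      Quad.vee, Quad.wedge, h']

theorem IsOpHom.map_jIdentity {m : BilinOps F JOp A} {m' : BilinOps F JOp B}
    {ψ : A →ₗ[F] B} (h : IsOpHom m m' ψ) (x y z t : A) (i : Fin 5) :
    ψ (JDend.identity m x y z t i) = JDend.identity m' (ψ x) (ψ y) (ψ z) (ψ t) i := by
  have h' : ∀ o a b, ψ (m o a b) = m' o (ψ a) (ψ b) := h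
  fin_cases i <;> simp [JDend.identity, JDend.circ, JDend.dot, JDend.diam, h']

theorem IsOpHom.quadToJ {m : BilinOps F QuadOp A} {m' : BilinOps F QuadOp B}
    {ψ : A →ₗ[F] B} (h : IsOpHom m m' ψ) : IsOpHom (quadToJ m) (quadToJ m') ψ := by
  have h' : ∀ o a b, ψ (m o a b) = m' o (ψ a) (ψ b) := h
  intro o a b
  cases o <;> simp [_root_.quadToJ, h']

/-- The universal property of the free alternative quadrialgebra. -/
theorem FreeAltQuad.exists_isOpHom {Y : Type*} {m : BilinOps F QuadOp A}
    (hm : IsAlternativeQuadrialgebra m) (a : Y → A) :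
    ∃ ψ : FreeAltQuad F Y →ₗ[F] A, IsOpHom (FreeAltQuad.ops F Y) m ψ ∧
      ∀ y, ψ (Submodule.Quotient.mk (FreeOpAlg.var F QuadOp y)) = a y := by
  have he := FreeOpAlg.isOpHom_eval m a
  have hle : opIdeal (FreeOpAlg.ops F QuadOp Y) (quadRelations F Y) ≤
      LinearMap.ker (FreeOpAlg.eval m a) := by
    refine sInf_le ⟨?_, fun o p q hq => ?_⟩
    · rintro _ ⟨x, y, z, i, rfl⟩
      exact (he.map_quadIdentity x y z i).trans (hm _ _ _ i)
    · rw [LinearMap.mem_ker] at hq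
      simp [he o, hq]
  refine ⟨Submodule.liftQ _ _ hle, fun o p q => ?_, fun y => ?_⟩
  · obtain ⟨p, rfl⟩ := Submodule.Quotient.mk_surjective _ p
    obtain ⟨q, rfl⟩ := Submodule.Quotient.mk_surjective _ q
    exact he o p q
  · exact FreeOpAlg.eval_var m a y

end Hom

/-! ### Transfer of identities from the free quadrialgebra to the matrix quadrialgebras. -/

section Vanishing

variable {F X : Type*} [Field F]

/-- Four generators suffice: they are sent to the four matrix units on the superdiagonal, whose sums
are all the values of `wordSubst`. -/
theorem eval_wordSubst_eq_zero {Y : Type*} (hY : 4 ≤ Cardinal.mk Y) {f : FreeOpAlg F JOp X}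
    (hf : FreeOpAlg.IsIdentity (quadToJ (FreeAltQuad.ops F Y)) f) {ρ₁ ρ₂ : ℕ → ℕ}
    (h₁ : Function.Injective ρ₁) (h₂ : Function.Injective ρ₂) (w : ℕ → X) :
    FreeOpAlg.eval (quadToJ (rankOps F ρ₁ ρ₂)) (wordSubst F w) f = 0 := by
  classical
  obtain ⟨y⟩ : Nonempty (Fin 4 ↪ Y) := by
    rw [← Cardinal.lift_mk_le']
    simpa using hY
  obtain ⟨ψ, hψ, e⟩ := FreeAltQuad.exists_isOpHom
    (isAlternativeQuadrialgebra_rankOps (F := F) h₁ h₂)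
    (Function.extend y (fun i => superdiag F i) 0)
  -- A preimage of `wordSubst F w` under `ψ`; a variable that is repeated in the word becomes a sum
  -- of generators.
  let b : X → FreeAltQuad F Y := fun x => ∑ i : Fin 4,
    if w i = x then Submodule.Quotient.mk (FreeOpAlg.var F QuadOp (y i)) else 0
  have hb : (fun x => ψ (b x)) = wordSubst F w := by
    funext x
    simp only [b, map_sum, apply_ite ψ, e, map_zero, y.injective.extend_apply, wordSubst,
      Finset.sum_range]
  rw [← hb, ← hψ.quadToJ.map_eval, hf, map_zero]

/-- The substitution of variables in a monomial. -/
def OpTree.map {Ω X Y : Type*} (φ : X → Y) : OpTree Ω X → OpTree Ω Y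
  | .var x => .var (φ x)
  | .node o S T => .node o (S.map φ) (T.map φ)

theorem OpTree.map_id {Ω X : Type*} (T : OpTree Ω X) : T.map id = T := by
  induction T with
  | var x => rfl
  | node o S T hS hT => simp [OpTree.map, hS, hT]

/-- The substitution of variables in a ranked monomial. -/
def RankedTree.map {X Y : Type*} (φ : X → Y) (A : RankedTree X) : RankedTree Y := (A.1.map φ, A.2)

theorem RankedTree.map_mul {X Y : Type*} (φ : X → Y) (A B : RankedTree X) :
    (RankedTree.mul A B).map φ = .mul (A.map φ) (B.map φ) := by
  by_cases h₁ : A.2.1 < B.2.1 <;> by_cases h₂ : A.2.2 < B.2.2 <;>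
    simp [RankedTree.map, RankedTree.mul, OpTree.map, h₁, h₂]

theorem bracketSum_map {Y : Type*} (φ : X → Y) (c : OpTree JOp Y → F) (A B C D : RankedTree X) :
    RankedTree.bracketSum (fun T => c (T.map φ)) A B C D =
      RankedTree.bracketSum c (A.map φ) (B.map φ) (C.map φ) (D.map φ) := by
  have e : ∀ A : RankedTree X, A.1.map φ = (A.map φ).1 := fun _ => rfl
  simp only [RankedTree.bracketSum, e, RankedTree.map_mul]

/-- An injective extension of a ranking of four positions. -/
def extendRank (w : Fin 4 → Fin 4) (n : ℕ) : ℕ := if h : n < 4 then w ⟨n, h⟩ else n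

theorem extendRank_injective {w : Fin 4 → Fin 4} (hw : Function.Injective w) :
    Function.Injective (extendRank w) := by
  intro a b h
  unfold extendRank at h
  split_ifs at h with ha hb hb
  · simpa using hw (Fin.ext h)
  · omega
  · omega
  · exact h

theorem bracketSumsVanish_of_eval_eq_zero {f : FreeOpAlg F JOp X}
    (hf : ∀ ρ₁ ρ₂ : ℕ → ℕ, Function.Injective ρ₁ → Function.Injective ρ₂ → ∀ w : ℕ → X,
      FreeOpAlg.eval (quadToJ (rankOps F ρ₁ ρ₂)) (wordSubst F w) f = 0) (φ : Fin 4 → X) :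
    BracketSumsVanish fun T => f (T.map φ) := by
  intro w₁ w₂ h₁ h₂ i j k l n
  have hv : Function.Injective ![i, j, k, l] := by
    simpa [List.ofFn_succ] using (List.nodup_ofFn (f := ![i, j, k, l])).1 (by simpa using n)
  rw [bracketSum_map]
  -- The matrix quadrialgebra ranks positions whereas `BracketSumsVanish` ranks letters, so the
  -- rankings are composed with the word. Only the positions 0 to 3 matter; `Fin.ofNat 4` merely
  -- continues the word beyond them.
  have e := bracketSum_eq_zero (hf _ _ (extendRank_injective (h₁.comp hv))
    (extendRank_injective (h₂.comp hv)) fun n => φ (![i, j, k, l] (Fin.ofNat 4 n)))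
  exact e

end Vanishing

/-! ### Coefficients of the J-dendriform identities. -/

section Coefficients

variable {F : Type*} [Field F]

/-- By (1) the J-dendriform identities hold in every matrix quadrialgebra, so they satisfy the same
linear relations as `f`. -/
theorem bracketSumsVanish_jIdentity (x y z t : FreeOpAlg F JOp (Fin 4)) (i : Fin 5) :
    BracketSumsVanish ⇑(JDend.identity (FreeOpAlg.ops F JOp (Fin 4)) x y z t i) := by
  have h := bracketSumsVanish_of_eval_eq_zero
    (f := JDend.identity (FreeOpAlg.ops F JOp (Fin 4)) x y z t i) (fun ρ₁ ρ₂ h₁ h₂ w => by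
      rw [(FreeOpAlg.isOpHom_eval _ _).map_jIdentity]
      exact (isAlternativeQuadrialgebra_rankOps h₁ h₂).isJDendriform _ _ _ _ i) id
  simpa only [OpTree.map_id] using h

/-- The product of integral polynomials, given by their coefficients. -/
def coeffMul {X : Type*} : JOp → (OpTree JOp X → ℤ) → (OpTree JOp X → ℤ) → OpTree JOp X → ℤ
  | .left, p, q, .node .left S T => p S * q T
  | .right, p, q, .node .right S T => p S * q T
  | _, _, _, _ => 0

/-- The coefficients of a variable. -/
def coeffVar {X : Type*} [DecidableEq X] (x : X) : OpTree JOp X → ℤ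
  | .var y => if x = y then 1 else 0
  | _ => 0

/-- The coefficients of `dot`. -/
def coeffDot {X : Type*} (p q : OpTree JOp X → ℤ) : OpTree JOp X → ℤ :=
  coeffMul .right p q + coeffMul .left q p

/-- The coefficients of `diam`. -/
def coeffDiam {X : Type*} (p q : OpTree JOp X → ℤ) : OpTree JOp X → ℤ :=
  coeffMul .right p q + coeffMul .left p q

/-- The coefficients of `circ`. -/
def coeffCirc {X : Type*} (p q : OpTree JOp X → ℤ) : OpTree JOp X → ℤ :=
  coeffDot p q + coeffDot q p

/-- The integral coefficients of the J-dendriform identities in variables. -/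
def jCoeff {X : Type*} [DecidableEq X] (a b c d : X) : Fin 5 → OpTree JOp X → ℤ :=
  let R := coeffMul (X := X) .right
  let L := coeffMul (X := X) .left
  let x := coeffVar a
  let y := coeffVar b
  let z := coeffVar c
  let t := coeffVar d
  ![R (coeffCirc x y) (R z t) + R (coeffCirc y z) (R x t) + R (coeffCirc z x) (R y t)
      - R x (R (coeffCirc y z) t) - R y (R (coeffCirc z x) t) - R z (R (coeffCirc x y) t),
    R (coeffCirc x y) (R z t) + R (coeffCirc y z) (R x t) + R (coeffCirc z x) (R y t)
      - R x (R y (R z t)) - R z (R y (R x t)) - R (coeffCirc y (coeffCirc z x)) t,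
    R (coeffCirc x y) (L z t) + L (coeffDot x z) (coeffDiam y t) + L (coeffDot y z) (coeffDiam x t)
      - R x (L z (coeffDiam y t)) - R y (L z (coeffDiam x t)) - L (coeffDot (coeffCirc x y) z) t,
    L (coeffDot z y) (coeffDiam x t) + L (coeffDot x y) (coeffDiam z t) + R (coeffCirc x z) (L y t)
      - R x (L (coeffDot z y) t) - R z (L (coeffDot x y) t) - L y (coeffDiam (coeffCirc x z) t),
    R (coeffCirc x y) (L z t) + L (coeffDot x z) (coeffDiam y t) + L (coeffDot y z) (coeffDiam x t)
      - R x (R y (L z t)) - L z (coeffDiam y (coeffDiam x t)) - L (coeffDot y (coeffDot x z)) t]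

/-- `P` has the integral coefficients `p`. -/
def HasCoeffs {X : Type*} (P : FreeOpAlg F JOp X) (p : OpTree JOp X → ℤ) : Prop := ∀ T, P T = p T

namespace HasCoeffs

variable {X : Type*} {P Q : FreeOpAlg F JOp X} {p q : OpTree JOp X → ℤ}

theorem add (hP : HasCoeffs P p) (hQ : HasCoeffs Q q) : HasCoeffs (P + Q) (p + q) := fun T => by
  simp [hP T, hQ T]

theorem sub (hP : HasCoeffs P p) (hQ : HasCoeffs Q q) : HasCoeffs (P - Q) (p - q) := fun T => by
  simp [hP T, hQ T]

theorem var [DecidableEq X] (x : X) : HasCoeffs (FreeOpAlg.var F JOp x) (coeffVar x) := by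
  classical
  intro T
  cases T <;> simp [FreeOpAlg.var, coeffVar, Finsupp.single_apply]

theorem ops_apply_node (o o' : JOp) (P Q : FreeOpAlg F JOp X) (S T : OpTree JOp X)
    [Decidable (o = o')] :
    FreeOpAlg.ops F JOp X o P Q (.node o' S T) = if o = o' then P S * Q T else 0 := by
  classical
  induction P using Finsupp.induction_linear with
  | zero => simp
  | add P P' hP hP' =>
    simp only [map_add, LinearMap.add_apply, Finsupp.add_apply, hP, hP']
    split_ifs <;> ring
  | single A a =>
    induction Q using Finsupp.induction_linear with
    | zero => simp
    | add Q Q' hQ hQ' =>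
      simp only [map_add, Finsupp.add_apply, hQ, hQ']
      split_ifs <;> ring
    | single B b =>
      rw [FreeOpAlg.ops_single]
      simp only [Finsupp.single_apply, OpTree.node.injEq]
      split_ifs <;> simp_all

theorem ops_apply_var (o : JOp) (P Q : FreeOpAlg F JOp X) (x : X) :
    FreeOpAlg.ops F JOp X o P Q (.var x) = 0 := by
  classical
  induction P using Finsupp.induction_linear with
  | zero => simp
  | add P P' hP hP' => simp [hP, hP']
  | single A a =>
    induction Q using Finsupp.induction_linear with
    | zero => simp
    | add Q Q' hQ hQ' => simp [hQ, hQ']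
    | single B b => simp [FreeOpAlg.ops_single]

theorem mul (o : JOp) (hP : HasCoeffs P p) (hQ : HasCoeffs Q q) :
    HasCoeffs (FreeOpAlg.ops F JOp X o P Q) (coeffMul o p q) := by
  classical
  rintro (x | ⟨o', S, T⟩)
  · rw [ops_apply_var]
    cases o <;> simp [coeffMul]
  · rw [ops_apply_node]
    cases o <;> cases o' <;> simp [coeffMul, hP S, hQ T]

theorem dot (hP : HasCoeffs P p) (hQ : HasCoeffs Q q) :
    HasCoeffs (JDend.dot (FreeOpAlg.ops F JOp X) P Q) (coeffDot p q) :=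
  (hP.mul .right hQ).add (hQ.mul .left hP)

theorem diam (hP : HasCoeffs P p) (hQ : HasCoeffs Q q) :
    HasCoeffs (JDend.diam (FreeOpAlg.ops F JOp X) P Q) (coeffDiam p q) :=
  (hP.mul .right hQ).add (hP.mul .left hQ)

theorem circ (hP : HasCoeffs P p) (hQ : HasCoeffs Q q) :
    HasCoeffs (JDend.circ (FreeOpAlg.ops F JOp X) P Q) (coeffCirc p q) :=
  (hP.dot hQ).add (hQ.dot hP)

/-- The coefficients come from computable integer functions independent of `F`, so they can be
evaluated by `decide`. -/
theorem jIdentity [DecidableEq X] (a b c d : X) (i : Fin 5) :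
    HasCoeffs (JDend.identity (FreeOpAlg.ops F JOp X) (.var F JOp a) (.var F JOp b)
      (.var F JOp c) (.var F JOp d) i) (jCoeff a b c d i) := by
  have x := var (F := F) a
  have y := var (F := F) b
  have z := var (F := F) c
  have t := var (F := F) d
  fin_cases i
  · exact ((((((mul .right (circ x y) (mul .right z t))).add (mul .right (circ y z) (mul .right
      x t))).add (mul .right (circ z x) (mul .right y t))).sub (mul .right x (mul .right (circ y
      z) t))).sub (mul .right y (mul .right (circ z x) t))).sub (mul .right z (mul .right (circ
      x y) t))
  · exact ((((((mul .right (circ x y) (mul .right z t))).add (mul .right (circ y z) (mul .right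
      x t))).add (mul .right (circ z x) (mul .right y t))).sub (mul .right x (mul .right y (mul
      .right z t)))).sub (mul .right z (mul .right y (mul .right x t)))).sub (mul .right (circ y
      (circ z x)) t)
  · exact ((((((mul .right (circ x y) (mul .left z t))).add (mul .left (dot x z) (diam y
      t))).add (mul .left (dot y z) (diam x t))).sub (mul .right x (mul .left z (diam y
      t)))).sub (mul .right y (mul .left z (diam x t)))).sub (mul .left (dot (circ x y) z) t)
  · exact ((((((mul .left (dot z y) (diam x t))).add (mul .left (dot x y) (diam z t))).add (mul
      .right (circ x z) (mul .left y t))).sub (mul .right x (mul .left (dot z y) t))).sub (mul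
      .right z (mul .left (dot x y) t))).sub (mul .left y (diam (circ x z) t))
  · exact ((((((mul .right (circ x y) (mul .left z t))).add (mul .left (dot x z) (diam y
      t))).add (mul .left (dot y z) (diam x t))).sub (mul .right x (mul .right y (mul .left z
      t)))).sub (mul .left z (diam y (diam x t)))).sub (mul .left (dot y (dot x z)) t)

end HasCoeffs

end Coefficients

/-! ### The 64 J-dendriform instances dual to the reference combs. -/

section KeyLemma

/-- The index of the J-dendriform identity with the combs with third letter `t` in which `l` and
`l'` are the letters of highest rank. -/
def jIndex (t l l' : Fin 4) : Fin 5 :=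
  if l = t then if l' = t then 0 else 3
  else if l' = t then 2 else if l = l' then 1 else 4

/-- The variables of the J-dendriform identity with the combs with third letter `t` in which `l`
and `l'` are the letters of highest rank. -/
def jVars (t l l' : Fin 4) : Fin 4 → Fin 4 :=
  let r := (List.finRange 4).filter fun i => i ≠ t ∧ i ≠ l ∧ i ≠ l'
  -- The default 0 never enters the vector that is selected: `r` has three letters if `l = l' = t`,
  -- one if `t`, `l`, `l'` are distinct, and two otherwise.
  let a := r.getD 0 0
  let b := r.getD 1 0
  let c := r.getD 2 0
  ![![a, b, c, t], ![a, t, b, l], ![a, b, t, l], ![a, l', b, t], ![a, t, l', l]] (jIndex t l l')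

theorem jVars_injective : ∀ t l l', Function.Injective (jVars t l l') := by decide

/-- Duality of the chosen instances with the reference combs, up to sign; this is what makes the
instances attain the upper bound 64. -/
theorem jCoeff_refComb : ∀ t l l' s k k', jCoeff (jVars t l l' 0) (jVars t l l' 1)
    (jVars t l l' 2) (jVars t l l' 3) (jIndex t l l') (refComb s k k') =
      if t = s ∧ l = k ∧ l' = k' then -1 else 0 := by
  decide

theorem sum_jVars : ∀ t l l', ({jVars t l l' 0} + {jVars t l l' 1} + {jVars t l l' 2} +
    {jVars t l l' 3} : Multiset (Fin 4)) = (Finset.univ : Finset (Fin 4)).val := by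
  decide

variable {F : Type*} [Field F]

/-- The polynomials all of whose monomials have the variables `μ`. -/
def multiHomogeneous (F : Type*) [Field F] {Ω X : Type*} (μ : Multiset X) :
    Submodule F (FreeOpAlg F Ω X) :=
  Finsupp.supported F F {T | T.leaves = μ}

theorem mem_multiHomogeneous {Ω X : Type*} {μ : Multiset X} {f : FreeOpAlg F Ω X} :
    f ∈ multiHomogeneous F μ ↔ ∀ T ∈ f.support, T.leaves = μ := Iff.rfl

namespace multiHomogeneous

variable {X : Type*} {μ ν : Multiset X} {p q : FreeOpAlg F JOp X}

theorem var (x : X) : FreeOpAlg.var F JOp x ∈ multiHomogeneous F {x} :=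
  Finsupp.single_mem_supported _ _ rfl

theorem mul (o : JOp) (hp : p ∈ multiHomogeneous F μ) (hq : q ∈ multiHomogeneous F ν) :
    FreeOpAlg.ops F JOp X o p q ∈ multiHomogeneous F (μ + ν) := by
  rw [mem_multiHomogeneous] at hp hq ⊢
  rintro (x | ⟨o', S, T⟩) h
  · simp [HasCoeffs.ops_apply_var] at h
  · classical
    rw [Finsupp.mem_support_iff, HasCoeffs.ops_apply_node] at h
    have h' : p S * q T ≠ 0 := fun e => h (by simp [e])
    rw [OpTree.leaves, hp S (Finsupp.mem_support_iff.2 (left_ne_zero_of_mul h')),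
      hq T (Finsupp.mem_support_iff.2 (right_ne_zero_of_mul h'))]

theorem mul' (o : JOp) (hp : p ∈ multiHomogeneous F μ) (hq : q ∈ multiHomogeneous F ν) :
    FreeOpAlg.ops F JOp X o q p ∈ multiHomogeneous F (μ + ν) :=
  add_comm ν μ ▸ mul o hq hp

theorem dot (hp : p ∈ multiHomogeneous F μ) (hq : q ∈ multiHomogeneous F ν) :
    JDend.dot (FreeOpAlg.ops F JOp X) p q ∈ multiHomogeneous F (μ + ν) :=
  add_mem (mul _ hp hq) (mul' _ hp hq)

theorem diam (hp : p ∈ multiHomogeneous F μ) (hq : q ∈ multiHomogeneous F ν) :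
    JDend.diam (FreeOpAlg.ops F JOp X) p q ∈ multiHomogeneous F (μ + ν) :=
  add_mem (mul _ hp hq) (mul _ hp hq)

theorem circ (hp : p ∈ multiHomogeneous F μ) (hq : q ∈ multiHomogeneous F ν) :
    JDend.circ (FreeOpAlg.ops F JOp X) p q ∈ multiHomogeneous F (μ + ν) :=
  add_mem (dot hp hq) (add_comm ν μ ▸ dot hq hp)

theorem cast (hp : p ∈ multiHomogeneous F μ) (h : μ = ν) : p ∈ multiHomogeneous F ν := h ▸ hp

theorem combination {p₁ p₂ p₃ p₄ p₅ p₆ : FreeOpAlg F JOp X} (h₁ : p₁ ∈ multiHomogeneous F μ)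
    (h₂ : p₂ ∈ multiHomogeneous F μ) (h₃ : p₃ ∈ multiHomogeneous F μ)
    (h₄ : p₄ ∈ multiHomogeneous F μ) (h₅ : p₅ ∈ multiHomogeneous F μ)
    (h₆ : p₆ ∈ multiHomogeneous F μ) :
    p₁ + p₂ + p₃ - p₄ - p₅ - p₆ ∈ multiHomogeneous F μ :=
  sub_mem (sub_mem (sub_mem (add_mem (add_mem h₁ h₂) h₃) h₄) h₅) h₆

theorem jIdentity (a b c d : X) (i : Fin 5) :
    JDend.identity (FreeOpAlg.ops F JOp X) (.var F JOp a) (.var F JOp b) (.var F JOp c)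
      (.var F JOp d) i ∈ multiHomogeneous F ({a} + {b} + {c} + {d}) := by
  have x := var (F := F) a
  have y := var (F := F) b
  have z := var (F := F) c
  have t := var (F := F) d
  fin_cases i
  · refine combination ?_ ?_ ?_ ?_ ?_ ?_
    · exact cast (mul .right (circ x y) (mul .right z t)) (by abel)
    · exact cast (mul .right (circ y z) (mul .right x t)) (by abel)
    · exact cast (mul .right (circ z x) (mul .right y t)) (by abel)
    · exact cast (mul .right x (mul .right (circ y z) t)) (by abel)
    · exact cast (mul .right y (mul .right (circ z x) t)) (by abel)
    · exact cast (mul .right z (mul .right (circ x y) t)) (by abel)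
  · refine combination ?_ ?_ ?_ ?_ ?_ ?_
    · exact cast (mul .right (circ x y) (mul .right z t)) (by abel)
    · exact cast (mul .right (circ y z) (mul .right x t)) (by abel)
    · exact cast (mul .right (circ z x) (mul .right y t)) (by abel)
    · exact cast (mul .right x (mul .right y (mul .right z t))) (by abel)
    · exact cast (mul .right z (mul .right y (mul .right x t))) (by abel)
    · exact cast (mul .right (circ y (circ z x)) t) (by abel)
  · refine combination ?_ ?_ ?_ ?_ ?_ ?_
    · exact cast (mul .right (circ x y) (mul .left z t)) (by abel)
    · exact cast (mul .left (dot x z) (diam y t)) (by abel)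
    · exact cast (mul .left (dot y z) (diam x t)) (by abel)
    · exact cast (mul .right x (mul .left z (diam y t))) (by abel)
    · exact cast (mul .right y (mul .left z (diam x t))) (by abel)
    · exact cast (mul .left (dot (circ x y) z) t) (by abel)
  · refine combination ?_ ?_ ?_ ?_ ?_ ?_
    · exact cast (mul .left (dot z y) (diam x t)) (by abel)
    · exact cast (mul .left (dot x y) (diam z t)) (by abel)
    · exact cast (mul .right (circ x z) (mul .left y t)) (by abel)
    · exact cast (mul .right x (mul .left (dot z y) t)) (by abel)
    · exact cast (mul .right z (mul .left (dot x y) t)) (by abel)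
    · exact cast (mul .left y (diam (circ x z) t)) (by abel)
  · refine combination ?_ ?_ ?_ ?_ ?_ ?_
    · exact cast (mul .right (circ x y) (mul .left z t)) (by abel)
    · exact cast (mul .left (dot x z) (diam y t)) (by abel)
    · exact cast (mul .left (dot y z) (diam x t)) (by abel)
    · exact cast (mul .right x (mul .right y (mul .left z t))) (by abel)
    · exact cast (mul .left z (diam y (diam x t))) (by abel)
    · exact cast (mul .left (dot y (dot x z)) t) (by abel)

end multiHomogeneous

/-- The polynomials whose bracketing sums vanish. -/
def bracketSubmodule (F : Type*) [Field F] : Submodule F (FreeOpAlg F JOp (Fin 4)) where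
  carrier := {f | BracketSumsVanish ⇑f}
  zero_mem' := fun w₁ w₂ h₁ h₂ i j k l n => by simp [RankedTree.bracketSum]
  add_mem' {f g} hf hg w₁ w₂ h₁ h₂ i j k l n := by
    have e := hf w₁ w₂ h₁ h₂ i j k l n
    have e' := hg w₁ w₂ h₁ h₂ i j k l n
    simp only [RankedTree.bracketSum, Finsupp.add_apply] at e e' ⊢
    linear_combination e + e'
  smul_mem' a {f} hf w₁ w₂ h₁ h₂ i j k l n := by
    have e := hf w₁ w₂ h₁ h₂ i j k l n
    simp only [RankedTree.bracketSum, Finsupp.smul_apply, smul_eq_mul] at e ⊢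
    linear_combination a * e

/-- A multilinear polynomial of degree four whose bracketing sums vanish is a linear combination
of the J-dendriform identities. -/
theorem mem_span_of_bracketSumsVanish (h2 : (2 : F) ≠ 0) {f : FreeOpAlg F JOp (Fin 4)}
    (hm : f.IsMultilinear) (hf : BracketSumsVanish ⇑f) :
    f ∈ Submodule.span F
        {r | ∃ (σ : Equiv.Perm (Fin 4)) (i : Fin 5),
          r = JDend.identity (FreeOpAlg.ops F JOp (Fin 4))
            (FreeOpAlg.var F JOp (σ 0)) (FreeOpAlg.var F JOp (σ 1))
            (FreeOpAlg.var F JOp (σ 2)) (FreeOpAlg.var F JOp (σ 3)) i} := by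
  let J : Fin 4 × Fin 4 × Fin 4 → FreeOpAlg F JOp (Fin 4) := fun s =>
    JDend.identity (FreeOpAlg.ops F JOp (Fin 4)) (.var F JOp (jVars s.1 s.2.1 s.2.2 0))
      (.var F JOp (jVars s.1 s.2.1 s.2.2 1)) (.var F JOp (jVars s.1 s.2.1 s.2.2 2))
      (.var F JOp (jVars s.1 s.2.1 s.2.2 3)) (jIndex s.1 s.2.1 s.2.2)
  -- As `J s` has coefficient `-1` at its own reference comb, `f + g` vanishes at all of them. It
  -- still is multilinear and satisfies the relations, hence is zero.
  let g := ∑ s, f (refComb s.1 s.2.1 s.2.2) • J s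
  have hJm : ∀ s, J s ∈ multiHomogeneous F (Finset.univ : Finset (Fin 4)).val := fun s => by
    refine multiHomogeneous.cast (multiHomogeneous.jIdentity _ _ _ _ _) ?_
    exact sum_jVars s.1 s.2.1 s.2.2
  have hadd : f + g = 0 := by
    have hV : BracketSumsVanish ⇑(f + g) := (bracketSubmodule F).add_mem hf
      (Submodule.sum_mem _ fun s _ => Submodule.smul_mem _ _
        (bracketSumsVanish_jIdentity _ _ _ _ _))
    have hM : f + g ∈ multiHomogeneous F (Finset.univ : Finset (Fin 4)).val :=
      add_mem hm (Submodule.sum_mem _ fun s _ => Submodule.smul_mem _ _ (hJm s))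
    have h0 : ∀ t l l', (f + g) (refComb t l l') = 0 := by
      intro t l l'
      have hc : ∀ s, J s (refComb t l l') = if s = (t, l, l') then (-1 : F) else 0 := by
        intro s
        rw [HasCoeffs.jIdentity _ _ _ _ _ _, jCoeff_refComb]
        obtain ⟨a, b, c⟩ := s
        simp only [Prod.mk.injEq]
        split_ifs <;> simp
      simp [g, hc]
    ext T
    by_contra hT
    exact hT (eq_zero_of_refComb_eq_zero h2 hV h0
      (mem_multiHomogeneous.1 hM T (Finsupp.mem_support_iff.2 hT)))
  rw [eq_neg_of_add_eq_zero_left hadd]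
  exact Submodule.neg_mem _ (Submodule.sum_mem _ fun s _ => Submodule.smul_mem _ _
    (Submodule.subset_span ⟨Equiv.ofBijective _
      (Finite.injective_iff_bijective.1 (jVars_injective s.1 s.2.1 s.2.2)), _, rfl⟩))

end KeyLemma

/-! ### Linearization of homogeneous identities of degree four. -/

section Linearization

variable {F X : Type*} [Field F]

instance JOp.instFintype : Fintype JOp :=
  ⟨⟨{.left, .right}, by simp⟩, by rintro (_ | _) <;> simp⟩

theorem quartic_injective {Ω : Type*} {s s' : Fin 5} {o o' : Ω × Ω × Ω} {x x' : Fin 4 → X}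
    (h : quartic s o x = quartic s' o' x') : s = s' ∧ o = o' ∧ x = x' := by
  obtain ⟨o₁, o₂, o₃⟩ := o
  obtain ⟨o₁', o₂', o₃'⟩ := o'
  have hx : x 0 = x' 0 → x 1 = x' 1 → x 2 = x' 2 → x 3 = x' 3 → x = x' := by
    intro h0 h1 h2 h3
    funext i
    fin_cases i
    exacts [h0, h1, h2, h3]
  fin_cases s <;> fin_cases s' <;> simp [quartic] at h ⊢ <;> grind

theorem map_quartic {Ω Y : Type*} (φ : X → Y) (s : Fin 5) (o : Ω × Ω × Ω) (x : Fin 4 → X) :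
    (quartic s o x).map φ = quartic s o (φ ∘ x) := by
  fin_cases s <;> rfl

theorem sum_single_quartic {f : FreeOpAlg F JOp X} {Φ : Finset (Fin 4 → X)}
    (h : ∀ T ∈ f.support, ∃ s o, ∃ x ∈ Φ, T = quartic s o x) :
    f = ∑ s, ∑ o, ∑ x ∈ Φ, Finsupp.single (quartic s o x) (f (quartic s o x)) := by
  classical
  let Q : Fin 5 × (JOp × JOp × JOp) × (Fin 4 → X) → OpTree JOp X := fun n => quartic n.1 n.2.1 n.2.2
  have hQ : Function.Injective Q := by
    rintro ⟨s, o, x⟩ ⟨s', o', x'⟩ h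
    obtain ⟨rfl, rfl, rfl⟩ := quartic_injective h
    rfl
  let N : Finset (Fin 5 × (JOp × JOp × JOp) × (Fin 4 → X)) := Finset.univ ×ˢ Finset.univ ×ˢ Φ
  have hN : f.support ⊆ N.image Q := by
    intro T hT
    obtain ⟨s, o, x, hx, rfl⟩ := h T hT
    exact Finset.mem_image.2 ⟨(s, o, x), by simp [N, hx], rfl⟩
  calc f = f.sum Finsupp.single := f.sum_single.symm
    _ = ∑ T ∈ N.image Q, Finsupp.single T (f T) :=
        Finsupp.sum_of_support_subset f hN _ (by simp)
    _ = ∑ n ∈ N, Finsupp.single (Q n) (f (Q n)) := Finset.sum_image hQ.injOn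
    _ = _ := by simp only [N, Finset.sum_product, Q]

theorem leaves_mul (A B : RankedTree X) :
    (RankedTree.mul A B).1.leaves = A.1.leaves + B.1.leaves := by
  by_cases h₁ : A.2.1 < B.2.1 <;> by_cases h₂ : A.2.2 < B.2.2 <;>
    simp [RankedTree.mul, OpTree.leaves, h₁, h₂, add_comm]

/-- Bracketings of a word in four different letters are multilinear, so the relations read no other
coefficients. -/
theorem BracketSumsVanish.congr {c c' : OpTree JOp (Fin 4) → F} (hc : BracketSumsVanish c)
    (h : ∀ T, T.leaves = (Finset.univ : Finset (Fin 4)).val → c' T = c T) :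
    BracketSumsVanish c' := by
  intro w₁ w₂ h₁ h₂ i j k l n
  have hu : ∀ i j k l : Fin 4, [i, j, k, l].Nodup →
      ({i} + ({j} + ({k} + {l})) : Multiset (Fin 4)) = (Finset.univ : Finset (Fin 4)).val := by
    decide
  rw [← hc w₁ w₂ h₁ h₂ i j k l n]
  unfold RankedTree.bracketSum
  rw [h, h, h, h, h] <;>
    (simp only [leaves_mul, add_assoc]
     exact hu i j k l n)

/-- The multilinear polynomial whose coefficients are those of `f` at the monomials that arise
from the substitution `φ`. -/
noncomputable def linearize (f : FreeOpAlg F JOp X) (φ : Fin 4 → X) : FreeOpAlg F JOp (Fin 4) :=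
  ∑ σ : Equiv.Perm (Fin 4), ∑ s, ∑ o,
    Finsupp.single (quartic s o σ) (f ((quartic s o σ).map φ))

theorem leaves_quartic_perm {Ω : Type*} (s : Fin 5) (o : Ω × Ω × Ω) (σ : Equiv.Perm (Fin 4)) :
    (quartic s o σ).leaves = (Finset.univ : Finset (Fin 4)).val := by
  rw [leaves_quartic]
  exact Multiset.map_univ_val_equiv σ

theorem isMultilinear_linearize (f : FreeOpAlg F JOp X) (φ : Fin 4 → X) :
    (linearize f φ).IsMultilinear := by
  have : linearize f φ ∈ multiHomogeneous F (Finset.univ : Finset (Fin 4)).val :=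
    Submodule.sum_mem _ fun σ _ => Submodule.sum_mem _ fun s _ => Submodule.sum_mem _ fun o _ =>
      Finsupp.single_mem_supported _ _ (leaves_quartic_perm s o σ)
  exact this

theorem linearize_apply (f : FreeOpAlg F JOp X) (φ : Fin 4 → X) {T : OpTree JOp (Fin 4)}
    (hT : T.leaves = (Finset.univ : Finset (Fin 4)).val) : linearize f φ T = f (T.map φ) := by
  classical
  obtain ⟨s, o, x, rfl⟩ := OpTree.exists_quartic_eq (T := T) (by simp [hT])
  have hx : Function.Injective x := by
    rw [leaves_quartic] at hT
    have : (Multiset.map x Finset.univ.val).Nodup := by rw [hT]; exact Finset.univ.nodup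
    exact fun i j h => Multiset.inj_on_of_nodup_map this i (by simp) j (by simp) h
  let σ : Equiv.Perm (Fin 4) := Equiv.ofBijective x (Finite.injective_iff_bijective.1 hx)
  have hσ : x = σ := rfl
  rw [hσ]
  simp only [linearize, Finsupp.finsetSum_apply, Finsupp.single_apply]
  rw [Finset.sum_eq_single_of_mem σ (Finset.mem_univ _),
    Finset.sum_eq_single_of_mem s (Finset.mem_univ _),
    Finset.sum_eq_single_of_mem o (Finset.mem_univ _), if_pos rfl]
  · exact fun o' _ h => if_neg fun e => h (quartic_injective e).2.1
  · exact fun s' _ h => Finset.sum_eq_zero fun o' _ => if_neg fun e => h (quartic_injective e).1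
  · exact fun σ' _ h => Finset.sum_eq_zero fun s' _ => Finset.sum_eq_zero fun o' _ =>
      if_neg fun e => h (DFunLike.coe_injective (quartic_injective e).2.2)

theorem treeEval_var {Y : Type*} (φ : X → Y) (T : OpTree JOp X) :
    T.eval (FreeOpAlg.ops F JOp Y) (fun x => FreeOpAlg.var F JOp (φ x)) =
      Finsupp.single (T.map φ) 1 := by
  induction T with
  | var x => rfl
  | node o S T hS hT => simp [OpTree.eval, OpTree.map, hS, hT, FreeOpAlg.ops_single]

/-- For each of the `4! = 24` permutations `σ`, the substitution `φ ↦ φ ∘ σ` permutes `Φ`, so the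
terms belonging to `σ` add up to one copy of `f`. -/
theorem sum_eval_linearize {f : FreeOpAlg F JOp X} {Φ : Finset (Fin 4 → X)}
    (hΦ : ∀ x ∈ Φ, ∀ σ : Equiv.Perm (Fin 4), x ∘ σ ∈ Φ)
    (h : ∀ T ∈ f.support, ∃ s o, ∃ x ∈ Φ, T = quartic s o x) :
    ∑ φ ∈ Φ, FreeOpAlg.eval (FreeOpAlg.ops F JOp X) (fun i => FreeOpAlg.var F JOp (φ i))
      (linearize f φ) = (24 : F) • f := by
  have hσ : ∀ σ : Equiv.Perm (Fin 4), ∑ s, ∑ o, ∑ φ ∈ Φ,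
      Finsupp.single (quartic s o (φ ∘ σ)) (f (quartic s o (φ ∘ σ))) = f := by
    intro σ
    conv_rhs => rw [sum_single_quartic h]
    refine Finset.sum_congr rfl fun s _ => Finset.sum_congr rfl fun o _ => ?_
    refine Finset.sum_nbij' (fun φ => φ ∘ σ) (fun φ => φ ∘ σ.symm) (fun φ hφ => hΦ φ hφ σ)
      (fun φ hφ => hΦ φ hφ σ.symm) (fun φ _ => ?_) (fun φ _ => ?_) (fun φ _ => rfl)
    · funext i; simp
    · funext i; simp
  have e : ∀ φ, FreeOpAlg.eval (FreeOpAlg.ops F JOp X) (fun i => FreeOpAlg.var F JOp (φ i))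
      (linearize f φ) = ∑ σ : Equiv.Perm (Fin 4), ∑ s, ∑ o,
        Finsupp.single (quartic s o (φ ∘ σ)) (f (quartic s o (φ ∘ σ))) := by
    intro φ
    simp only [linearize, map_sum, FreeOpAlg.eval, Finsupp.linearCombination_single, treeEval_var,
      Finsupp.smul_single, smul_eq_mul, mul_one, map_quartic]
  simp only [e]
  rw [Finset.sum_comm]
  have e' : ∀ σ : Equiv.Perm (Fin 4), ∑ φ ∈ Φ, ∑ s, ∑ o,
      Finsupp.single (quartic s o (φ ∘ σ)) (f (quartic s o (φ ∘ σ))) = f := by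
    intro σ
    rw [Finset.sum_comm]
    conv_rhs => rw [← hσ σ]
    exact Finset.sum_congr rfl fun s _ => Finset.sum_comm
  simp only [e', Finset.sum_const, Finset.card_univ, Fintype.card_perm, Fintype.card_fin]
  rw [← Nat.cast_smul_eq_nsmul F]
  norm_num [Nat.factorial]

/-- Each linearization is a combination of J-dendriform identities by the multilinear case.
Substituting variables maps it into the T-ideal, and 24 is invertible. -/
theorem mem_jDendTIdeal_of_isHomogeneous [CharZero F] {f : FreeOpAlg F JOp X}
    (hf : FreeOpAlg.IsHomogeneous 4 f)
    (h : ∀ φ : Fin 4 → X, BracketSumsVanish fun T => f (T.map φ)) : f ∈ jDendTIdeal F X := by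
  classical
  -- Since `X` may be infinite, the sum over substitutions is restricted to the finitely many
  -- variables that occur in `f`.
  let V : Finset X := f.support.biUnion fun T => T.leaves.toFinset
  let Φ : Finset (Fin 4 → X) := Fintype.piFinset fun _ => V
  have hΦ : ∀ x ∈ Φ, ∀ σ : Equiv.Perm (Fin 4), x ∘ σ ∈ Φ := by
    intro x hx σ
    simp only [Φ, Fintype.mem_piFinset] at hx ⊢
    exact fun i => hx (σ i)
  have hs : ∀ T ∈ f.support, ∃ s o, ∃ x ∈ Φ, T = quartic s o x := by
    intro T hT
    obtain ⟨s, o, x, rfl⟩ := OpTree.exists_quartic_eq (hf T hT)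
    refine ⟨s, o, x, ?_, rfl⟩
    simp only [Φ, V, Fintype.mem_piFinset, Finset.mem_biUnion, Multiset.mem_toFinset]
    exact fun i => ⟨_, hT, by rw [leaves_quartic]; exact Multiset.mem_map_of_mem x (by simp)⟩
  have h24 : (24 : F) • f ∈ jDendTIdeal F X := by
    rw [← sum_eval_linearize hΦ hs]
    refine Submodule.sum_mem _ fun φ _ => ?_
    have hl := mem_span_of_bracketSumsVanish two_ne_zero (isMultilinear_linearize f φ)
      ((h φ).congr fun T hT => linearize_apply f φ hT)
    refine (Submodule.span_le (p := (jDendTIdeal F X).comap (FreeOpAlg.eval _ _))).2 ?_ hl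
    rintro _ ⟨σ, i, rfl⟩
    rw [SetLike.mem_coe, Submodule.mem_comap, (FreeOpAlg.isOpHom_eval _ _).map_jIdentity]
    exact Submodule.mem_sInf.2 fun I hI => hI.1 ⟨_, _, _, _, i, rfl⟩
  exact (Submodule.smul_mem_iff _ (by norm_num)).1 h24

end Linearization

theorem mainTheorem5 {F : Type*} [Field F] :
    -- the two operations of an alternative quadrialgebra form a J-dendriform structure
    (∀ {A : Type*} [AddCommGroup A] [Module F A] (m : BilinOps F QuadOp A),
      IsAlternativeQuadrialgebra m → IsJDendriform (quadToJ m)) ∧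
    -- multilinear identities of degree four, in characteristic different from two
    ((2 : F) ≠ 0 → ∀ {Y : Type*}, 4 ≤ Cardinal.mk Y → ∀ f : FreeOpAlg F JOp (Fin 4),
      FreeOpAlg.IsMultilinear f →
      FreeOpAlg.IsIdentity (quadToJ (FreeAltQuad.ops F Y)) f →
      f ∈ Submodule.span F
        {r | ∃ (σ : Equiv.Perm (Fin 4)) (i : Fin 5),
          r = JDend.identity (FreeOpAlg.ops F JOp (Fin 4))
            (FreeOpAlg.var F JOp (σ 0)) (FreeOpAlg.var F JOp (σ 1))
            (FreeOpAlg.var F JOp (σ 2)) (FreeOpAlg.var F JOp (σ 3)) i}) ∧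
    -- arbitrary identities of degree four, in characteristic zero
    (CharZero F → ∀ {X Y : Type*}, 4 ≤ Cardinal.mk Y → ∀ f : FreeOpAlg F JOp X,
      FreeOpAlg.IsHomogeneous 4 f →
      FreeOpAlg.IsIdentity (quadToJ (FreeAltQuad.ops F Y)) f →
      f ∈ jDendTIdeal F X) := by
  refine ⟨fun m hm => hm.isJDendriform, fun h2 Y hY f hm hf => ?_, fun h0 X Y hY f hh hf => ?_⟩
  · refine mem_span_of_bracketSumsVanish h2 hm ?_
    have h := bracketSumsVanish_of_eval_eq_zero (fun ρ₁ ρ₂ h₁ h₂ w =>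
      eval_wordSubst_eq_zero hY hf h₁ h₂ w) id
    simpa only [OpTree.map_id] using h
  · exact mem_jDendTIdeal_of_isHomogeneous hh (bracketSumsVanish_of_eval_eq_zero
      fun ρ₁ ρ₂ h₁ h₂ w => eval_wordSubst_eq_zero hY hf h₁ h₂ w)
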